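/- **Theorem (Holomorphy of the Epstein zeta function).** Let $d\ge 1$, let $A\in\mathbb R^{d\times d}$ be invertible, and let $\Lambda=A\mathbb Z^d$ and $\Lambda^*=A^{-T}\mathbb Z^d$ be the corresponding lattice and its reciprocal lattice. For $x,y\in\mathbb R^d$ the lattice sum $$\sum_{z\in\Lambda\setminus\{x\}}\frac{e^{-2\pi i\,y\cdot z}}{|x-z|^{\nu}},\qquad \operatorname{Re}\nu>d,$$ converges absolutely and has a (unique) meromorphic continuation to $\nu\in\mathbb C$, the Epstein zeta function $Z_{\Lambda,\nu}(x,y)$. For $L\subseteq\mathbb R^d$ put $$D_L=\{u\in\mathbb C^d:\ |\operatorname{Re}u-z|>|\operatorname{Im}u|\ \text{ for all } z\in L\},$$ where real and imaginary parts are taken componentwise and $|\cdot|$ is the Euclidean norm. The sets $D_\Lambda$ and $D_{\Lambda^*}$ are open in $\mathbb C^d$, and the following hold. 1. There is a jointly holomorphic function $F$ on $\mathbb C\times D_\Lambda\times D_{\Lambda^*}$ with $F(\nu,x,y)=Z_{\Lambda,\nu}(x,y)$ for all $\nu\in\mathbb C$, $x\in\mathbb R^d\setminus\Lambda$, $y\in\mathbb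 R^d\setminus\Lambda^*$. 2. For every $x\in\Lambda$ there is a jointly holomorphic function $F$ on $\mathbb C\times D_{\Lambda^*}$ with $F(\nu,y)=Z_{\Lambda,\nu}(x,y)$ for all $\nu\in\mathbb C$, $y\in\mathbb R^d\setminus\Lambda^*$. 3. For every $y\in\Lambda^*$ there is a jointly holomorphic function $F$ on $(\mathbb C\setminus\{d\})\times D_\Lambda$ with $F(\nu,x)=Z_{\Lambda,\nu}(x,y)$ for all $\nu\in\mathbb C\setminus\{d\}$, $x\in\mathbb R^d\setminus\Lambda$, and for every $u\in D_\Lambda$ the function $\nu\mapsto F(\nu,u)$ has a simple pole at $\nu=d$. 4. For all $x\in\Lambda$ and $y\in\Lambda^*$, the function $\nu\mapsto Z_{\Lambda,\nu}(x,y)$ is holomorphic on $\mathbb C\setminus\{d\}$ and has a simple pole at $\nu=d$. -/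

import Mathlib

open Set

noncomputable section

/-- The lattice `A ℤ^d` in `ℝ^d` (Euclidean norm) generated by the columns of `A`. -/
def lattice {d : ℕ} (A : Matrix (Fin d) (Fin d) ℝ) : Set (EuclideanSpace ℝ (Fin d)) :=
  Set.range fun n : Fin d → ℤ => WithLp.toLp 2 (A.mulVec fun i => (n i : ℝ))

/-- The reciprocal lattice `A^{-T} ℤ^d` of `A ℤ^d`. -/
def reciprocalLattice {d : ℕ} (A : Matrix (Fin d) (Fin d) ℝ) : Set (EuclideanSpace ℝ (Fin d)) :=
  lattice (A⁻¹).transpose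

/-- `f` is the meromorphic continuation to `ℂ` of the lattice sum
`∑' exp (-2πi y·z) / |x - z|^ν`, `Re ν > d`, where `z` runs through `L` without `x`.
The sum converges absolutely to `f ν` for `Re ν > d`. The normal form condition fixes the values of
a meromorphic function at its removable singularities by continuity (and gives it
the dummy value `0` at its poles), so that there is at most one such `f`. -/
def IsEpsteinContinuation {d : ℕ} (L : Set (EuclideanSpace ℝ (Fin d)))
    (x y : EuclideanSpace ℝ (Fin d)) (f : ℂ → ℂ) : Prop :=
  MeromorphicNFOn f univ ∧
    ∀ ν : ℂ, (d : ℝ) < ν.re →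
      HasSum (fun z : ↥(L \ {x}) =>
        Complex.exp (-2 * Real.pi * Complex.I * (inner ℝ y z.1 : ℝ)) /
          ((‖x - z.1‖ : ℝ) : ℂ) ^ ν) (f ν)

open Classical in
/-- The Epstein zeta function, as a function of `ν`. -/
def epsteinZeta {d : ℕ} (L : Set (EuclideanSpace ℝ (Fin d)))
    (x y : EuclideanSpace ℝ (Fin d)) : ℂ → ℂ :=
  if h : ∃ f : ℂ → ℂ, IsEpsteinContinuation L x y f then h.choose else 0

/-- Componentwise real part. -/
def reVec {d : ℕ} (u : EuclideanSpace ℂ (Fin d)) : EuclideanSpace ℝ (Fin d) :=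
  WithLp.toLp 2 fun i => (u i).re

/-- Componentwise imaginary part. -/
def imVec {d : ℕ} (u : EuclideanSpace ℂ (Fin d)) : EuclideanSpace ℝ (Fin d) :=
  WithLp.toLp 2 fun i => (u i).im

/-- The inclusion of `ℝ^d` into `ℂ^d`. -/
def toComplexVec {d : ℕ} (x : EuclideanSpace ℝ (Fin d)) : EuclideanSpace ℂ (Fin d) :=
  WithLp.toLp 2 fun i => (x i : ℂ)

/-- The intersection `D_L` of the complex cones with vertices at the points of `L`. -/
def coneDomain {d : ℕ} (L : Set (EuclideanSpace ℝ (Fin d))) : Set (EuclideanSpace ℂ (Fin d)) :=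
  {u | ∀ z ∈ L, ‖imVec u‖ < ‖reVec u - z‖}

/-- `F` is (jointly) holomorphic on the open set `S`. -/
def IsHolomorphicOn {E : Type*} [NormedAddCommGroup E] [NormedSpace ℂ E]
    (F : E → ℂ) (S : Set E) : Prop :=
  IsOpen S ∧ DifferentiableOn ℂ F S

end

/-!
# Holomorphy of the Epstein zeta function

Write `Λ = A ℤ^d`, `Λ* = A^{-T} ℤ^d` and `e(a) = exp (-2πi a)`. Put `s = ν / 2` and let
`θ(t) = ∑_{z ∈ Λ \ {x}} e(y·z) exp (-π t |x - z|²)`. For `Re ν > d` the Mellin transform of `θ` at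
`s` is `π^{-s} Γ(s)` times the lattice sum. Following Riemann and Crandall, the Mellin integral is
cut at `t = 1` and `t ↦ 1/t` is substituted in the lower part. Poisson summation
(`hasSum_integral_exp_mul_eq_tsum_intCast`, deduced from Fourier series on the torus) turns
`θ(1/t)` into `t^{d/2} |det A|⁻¹` times a theta sum over `Λ*` (`tsum_lattice_thetaTerm`).
The terms `z = x` (if `x ∈ Λ`) and `q = y` (if `y ∈ Λ*`) do not decay in `t`; they are integrated
explicitly and give the only possible poles, at `s = 0` and `s = d/2`. This is
`mellin_tsum_thetaTerm`. After division by `Γ(s)` the pole at `s = 0` disappears, since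
`1 / (s Γ(s)) = 1 / Γ(s + 1)` is entire, and the pole at `ν = d` is present exactly if `y ∈ Λ*`,
with numerator `epsteinPolar`, which does not vanish at `d`.

The two remaining integrals over `(1, ∞)` make sense for complex vectors: `|x - z|²` becomes the
holomorphic expression `∑ (u_i - z_i)²`, whose real part `|Re u - z|² - |Im u|²` is positive for all
`z ∈ P` exactly on the cone domain of `P`. As `P` is contained in a lattice, this real part is
bounded below by `c (1 + |z|²)`, locally uniformly in `u`
(`exists_forall_mul_le_of_mem_coneDomain`). So the integrand has an integrable majorant locally
uniformly in all variables, and a Cauchy estimate shows that the integral is jointly holomorphic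
(`differentiableOn_integral_of_locally_dominated`, `differentiableOn_thetaMellin`).

The identity theorem for meromorphic functions in normal form identifies the resulting formula with
`epsteinZeta` (`epsteinZeta_lattice`).
-/

open MeasureTheory Filter Topology
open scoped Real

noncomputable section

/-! ### Holomorphic parameter integrals -/

/-- Cauchy estimate for the Fréchet derivative, from the one-variable estimate on complex lines. -/
theorem norm_fderiv_le_of_forall_mem_ball {E : Type*} [NormedAddCommGroup E] [NormedSpace ℂ E]
    {f : E → ℂ} {p : E} {r C : ℝ} (hr : 0 < r) (hf : DifferentiableOn ℂ f (Metric.ball p r))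
    (hC : ∀ q ∈ Metric.ball p r, ‖f q‖ ≤ C) : ‖fderiv ℂ f p‖ ≤ 2 * C / r := by
  have hC0 : 0 ≤ C := (norm_nonneg _).trans (hC p (Metric.mem_ball_self hr))
  refine ContinuousLinearMap.opNorm_le_bound _ (by positivity) fun v => ?_
  rcases eq_or_ne v 0 with rfl | hv
  · simp
  have hv' : 0 < ‖v‖ := norm_pos_iff.2 hv
  -- the disc of radius `ρ` in the complex line `p + ℂ v` stays inside the ball
  set ρ : ℝ := r / (2 * ‖v‖) with hρ
  have hρ0 : 0 < ρ := by positivity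
  have hmaps : MapsTo (fun z : ℂ => p + z • v) (Metric.closedBall 0 ρ) (Metric.ball p r) := by
    intro z hz
    rw [mem_closedBall_zero_iff] at hz
    rw [mem_ball_iff_norm, add_sub_cancel_left, norm_smul]
    calc ‖z‖ * ‖v‖ ≤ ρ * ‖v‖ := by gcongr
      _ = r / 2 := by rw [hρ]; field_simp
      _ < r := by linarith
  have hd : DifferentiableOn ℂ (fun z : ℂ => f (p + z • v)) (Metric.closedBall 0 ρ) :=
    hf.comp (by fun_prop) hmaps
  have h1 : ‖deriv (fun z : ℂ => f (p + z • v)) 0‖ ≤ C / ρ := by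
    refine Complex.norm_deriv_le_of_forall_mem_sphere_norm_le hρ0 ?_ fun z hz => ?_
    · exact hd.diffContOnCl_ball subset_rfl
    · exact hC _ (hmaps (Metric.sphere_subset_closedBall hz))
  have h2 : deriv (fun z : ℂ => f (p + z • v)) 0 = fderiv ℂ f p v := by
    have hfp : HasFDerivAt f (fderiv ℂ f p) (p + (0 : ℂ) • v) := by
      simpa using (hf.differentiableAt (Metric.ball_mem_nhds p hr)).hasFDerivAt
    have hg : HasDerivAt (fun z : ℂ => p + z • v) v 0 := by
      simpa using ((hasDerivAt_id (0 : ℂ)).smul_const v).const_add p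
    exact (hfp.comp_hasDerivAt 0 hg).deriv
  rw [h2] at h1
  refine h1.trans_eq ?_
  rw [hρ]; field_simp

/-- The derivative is a limit of difference quotients, hence measurable in the parameter. -/
theorem aestronglyMeasurable_fderiv_of_differentiableAt {E α : Type*} [NormedAddCommGroup E]
    [NormedSpace ℂ E] [FiniteDimensional ℂ E] [MeasurableSpace α] {μ : Measure α}
    {f : E → α → ℂ} {p : E} (hmeas : ∀ᶠ q in 𝓝 p, AEStronglyMeasurable (f q) μ)
    (hdiff : ∀ᵐ a ∂μ, DifferentiableAt ℂ (fun q => f q a) p) :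
    AEStronglyMeasurable (fun a => fderiv ℂ (fun q => f q a) p) μ := by
  have hdir (v : E) : AEStronglyMeasurable (fun a => fderiv ℂ (fun q => f q a) p v) μ := by
    obtain ⟨c, hc0, hc⟩ : ∃ c : ℕ → ℂ, (∀ n, c n ≠ 0) ∧ Tendsto c atTop (𝓝 0) :=
      ⟨fun n => 1 / ((n : ℂ) + 1), fun n => one_div_ne_zero (Nat.cast_add_one_ne_zero n),
        tendsto_one_div_add_atTop_nhds_zero_nat⟩
    have hq : Tendsto (fun n => p + c n • v) atTop (𝓝 p) := by
      simpa using (hc.smul_const v).const_add p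
    obtain ⟨N, hN⟩ := eventually_atTop.1 (hq.eventually hmeas)
    refine aestronglyMeasurable_of_tendsto_ae atTop
      (f := fun n a => (c (n + N))⁻¹ • (f (p + c (n + N) • v) a - f p a)) (fun n => ?_) ?_
    · have h : AEStronglyMeasurable (f (p + c (n + N) • v)) μ := hN _ (Nat.le_add_left N n)
      exact (h.sub hmeas.self_of_nhds).const_smul ((c (n + N))⁻¹)
    · filter_upwards [hdiff] with a ha
      have h1 : HasDerivAt (fun z : ℂ => f (p + z • v) a) (fderiv ℂ (fun q => f q a) p v) 0 := by
        have hfp : HasFDerivAt (fun q => f q a) (fderiv ℂ (fun q => f q a) p)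
            (p + (0 : ℂ) • v) := by simpa using ha.hasFDerivAt
        have hg : HasDerivAt (fun z : ℂ => p + z • v) v 0 := by
          simpa using ((hasDerivAt_id (0 : ℂ)).smul_const v).const_add p
        exact hfp.comp_hasDerivAt 0 hg
      have h2 := h1.tendsto_slope_zero
      have h3 : Tendsto (fun n => c (n + N)) atTop (𝓝[≠] 0) :=
        tendsto_nhdsWithin_iff.2 ⟨hc.comp (tendsto_add_atTop_nat N),
          Eventually.of_forall fun n => hc0 _⟩
      simpa [Function.comp_def] using h2.comp h3
  let b := Module.finBasis ℂ E
  have hrepr : (fun a => fderiv ℂ (fun q => f q a) p) = fun a =>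
      ∑ i, fderiv ℂ (fun q => f q a) p (b i) • LinearMap.toContinuousLinearMap (b.coord i) := by
    ext a v
    conv_lhs => rw [← b.sum_repr v]
    simp only [map_sum, map_smul, sum_apply, smul_apply,
      LinearMap.coe_toContinuousLinearMap', Module.Basis.coord_apply, smul_eq_mul]
    exact Finset.sum_congr rfl fun i _ => mul_comm _ _
  rw [hrepr]
  exact Finset.aestronglyMeasurable_fun_sum _ fun i _ => (hdir _).smul_const _

/-- An integral of holomorphic functions with a locally uniform integrable majorant is holomorphic.
The Cauchy estimate provides the majorant of the derivatives. -/
theorem differentiableOn_integral_of_locally_dominated {E α : Type*} [NormedAddCommGroup E]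
    [NormedSpace ℂ E] [FiniteDimensional ℂ E] [MeasurableSpace α] {μ : Measure α}
    {f : E → α → ℂ} {U : Set E} (hU : IsOpen U)
    (hmeas : ∀ p ∈ U, AEStronglyMeasurable (f p) μ)
    (hdiff : ∀ᵐ a ∂μ, DifferentiableOn ℂ (fun p => f p a) U)
    (hdom : ∀ p ∈ U, ∃ V ∈ 𝓝 p, ∃ bound : α → ℝ, Integrable bound μ ∧
      ∀ᵐ a ∂μ, ∀ q ∈ V, ‖f q a‖ ≤ bound a) :
    DifferentiableOn ℂ (fun p => ∫ a, f p a ∂μ) U := by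
  intro p hp
  obtain ⟨V, hV, bound, hbound, hle⟩ := hdom p hp
  obtain ⟨r, hr, hrV⟩ := Metric.mem_nhds_iff.1 (inter_mem hV (hU.mem_nhds hp))
  have hUnhds : ∀ᶠ q in 𝓝 p, AEStronglyMeasurable (f q) μ :=
    eventually_of_mem (hU.mem_nhds hp) hmeas
  refine DifferentiableAt.differentiableWithinAt ?_
  refine (hasFDerivAt_integral_of_dominated_of_fderiv_le
    (F' := fun q a => fderiv ℂ (fun q => f q a) q) (bound := fun a => 2 * bound a / (r / 2))
    (Metric.ball_mem_nhds p (half_pos hr)) hUnhds ?_ ?_ ?_ ?_ ?_).differentiableAt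
  · exact hbound.mono' (hmeas p hp) (hle.mono fun a ha => ha p (mem_of_mem_nhds hV))
  · exact aestronglyMeasurable_fderiv_of_differentiableAt hUnhds
      (hdiff.mono fun a ha => ha.differentiableAt (hU.mem_nhds hp))
  · filter_upwards [hle, hdiff] with a ha had q hq
    have hsub : Metric.ball q (r / 2) ⊆ Metric.ball p r := by
      refine Metric.ball_subset_ball' ?_
      have := Metric.mem_ball.1 hq
      linarith
    exact norm_fderiv_le_of_forall_mem_ball (half_pos hr)
      (had.mono fun z hz => (hrV (hsub hz)).2) fun z hz => ha z (hrV (hsub hz)).1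
  · exact (hbound.const_mul 2).div_const _
  · filter_upwards [hdiff] with a had q hq
    exact (had.differentiableAt (hU.mem_nhds
      (hrV (Metric.ball_subset_ball (by linarith) hq)).2)).hasFDerivAt

/-! ### Poisson summation on the integer lattice -/

/-- The half-open unit cube `(0, 1]^ι`. -/
def unitCube (ι : Type*) : Set (ι → ℝ) := {s | ∀ i, s i ∈ Ioc (0 : ℝ) (0 + 1)}

theorem measurableSet_unitCube (ι : Type*) [Fintype ι] : MeasurableSet (unitCube ι) := by
  have : unitCube ι = Set.pi univ fun _ => Ioc (0 : ℝ) (0 + 1) := by ext; simp [unitCube]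
  rw [this]
  exact MeasurableSet.univ_pi fun _ => measurableSet_Ioc

theorem norm_le_one_of_mem_unitCube {ι : Type*} [Fintype ι] {s : ι → ℝ} (hs : s ∈ unitCube ι) :
    ‖s‖ ≤ 1 := by
  refine (pi_norm_le_iff_of_nonneg zero_le_one).2 fun i => ?_
  have := hs i
  rw [zero_add] at this
  rw [Real.norm_of_nonneg this.1.le]
  exact this.2

/-- The integer translates of the half-open unit cube tile `ℝ^ι`. -/
theorem hasSum_setIntegral_unitCube_add_intCast {ι : Type*} [Fintype ι] {f : (ι → ℝ) → ℂ}
    (hf : Integrable f) :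
    HasSum (fun n : ι → ℤ => ∫ s in unitCube ι, f (s + fun i => (n i : ℝ))) (∫ s, f s) := by
  classical
  set T : (ι → ℤ) → Set (ι → ℝ) := fun n => (fun s => s + fun i => -(n i : ℝ)) ⁻¹' unitCube ι
    with hT
  have hTm (n) : MeasurableSet (T n) := measurableSet_unitCube ι |>.preimage (by fun_prop)
  have hmem (n s) : s ∈ T n ↔ ∀ i, n i = ⌈s i⌉ - 1 := by
    simp only [hT, unitCube, mem_preimage, mem_ofPred_eq, Pi.add_apply, mem_Ioc]
    refine forall_congr' fun i => ?_
    rw [eq_sub_iff_add_eq, eq_comm (b := ⌈s i⌉), Int.ceil_eq_iff]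
    push_cast
    constructor <;> rintro ⟨h1, h2⟩ <;> constructor <;> linarith
  have hU : ⋃ n, T n = univ := by
    refine eq_univ_of_forall fun s => mem_iUnion.2 ⟨fun i => ⌈s i⌉ - 1, ?_⟩
    simp [hmem]
  have hdis : Pairwise (Function.onFun Disjoint T) := by
    intro m n hmn
    refine Set.disjoint_left.2 fun s hm hn => hmn ?_
    rw [hmem] at hm hn
    exact funext fun i => (hm i).trans (hn i).symm
  have h := hasSum_integral_iUnion hTm hdis hf.integrableOn
  rw [hU, setIntegral_univ] at h
  refine h.congr_fun fun n => ?_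
  have h1 := (measurePreserving_add_right (volume : Measure (ι → ℝ))
    (fun i => -(n i : ℝ))).setIntegral_preimage_emb (MeasurableEquiv.addRight _).measurableEmbedding
      (fun s => f (s + fun i => (n i : ℝ))) (unitCube ι)
  rw [← h1]
  refine setIntegral_congr_fun (hTm n) fun s _ => ?_
  simp only [add_assoc]
  congr 1
  ext i
  simp

theorem mFourier_neg_apply_coe {ι : Type*} [Fintype ι] (k : ι → ℤ) (s : ι → ℝ) :
    UnitAddTorus.mFourier (-k) (fun i => (s i : UnitAddCircle)) =
      Complex.exp (-(2 * π * Complex.I * ∑ i, (k i : ℂ) * s i)) := by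
  simp only [UnitAddTorus.mFourier, ContinuousMap.coe_mk, fourier_coe_apply]
  rw [← Complex.exp_sum]
  congr 1
  rw [Finset.mul_sum, ← Finset.sum_neg_distrib]
  refine Finset.sum_congr rfl fun i _ => ?_
  simp
  ring

theorem exp_sum_intCast_add {ι : Type*} [Fintype ι] (k n : ι → ℤ) (s : ι → ℝ) :
    Complex.exp (-(2 * π * Complex.I * ∑ i, (k i : ℂ) * ((s + fun i => (n i : ℝ)) i : ℝ))) =
      Complex.exp (-(2 * π * Complex.I * ∑ i, (k i : ℂ) * s i)) := by
  rw [Complex.exp_eq_exp_iff_exists_int]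
  refine ⟨-∑ i, k i * n i, ?_⟩
  simp only [Pi.add_apply, Complex.ofReal_add, mul_add, Finset.sum_add_distrib]
  push_cast
  ring

/-- **Poisson summation** on `ℤ^ι`. -/
theorem hasSum_integral_exp_mul_eq_tsum_intCast {ι : Type*} [Fintype ι] {φ : (ι → ℝ) → ℂ}
    (hφ : Continuous φ) (hint : Integrable φ)
    (hdom : ∀ R : ℝ, ∃ u : (ι → ℤ) → ℝ, Summable u ∧
      ∀ n s, ‖s‖ ≤ R → ‖φ (s + fun i => (n i : ℝ))‖ ≤ u n)
    (hcoeff : Summable fun k : ι → ℤ =>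
      ∫ s, Complex.exp (-(2 * π * Complex.I * ∑ i, (k i : ℂ) * s i)) * φ s) :
    HasSum (fun k : ι → ℤ =>
      ∫ s, Complex.exp (-(2 * π * Complex.I * ∑ i, (k i : ℂ) * s i)) * φ s)
      (∑' n : ι → ℤ, φ fun i => (n i : ℝ)) := by
  set g : (ι → ℝ) → ℂ := fun s => ∑' n : ι → ℤ, φ (s + fun i => (n i : ℝ)) with hg
  have hgc : Continuous g := by
    rw [continuous_iff_continuousAt]
    intro s₀
    obtain ⟨u, hu, hle⟩ := hdom (‖s₀‖ + 1)
    refine ContinuousOn.continuousAt (s := Metric.ball s₀ 1)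
      (continuousOn_tsum (fun n => (hφ.comp (by fun_prop)).continuousOn) hu fun n s hs => ?_)
      (Metric.ball_mem_nhds _ one_pos)
    refine hle n s ?_
    have h1 := norm_le_norm_add_norm_sub' s s₀
    have h2 := mem_ball_iff_norm.1 hs
    linarith
  have hgper (m : ι → ℤ) (s) : g (s + fun i => (m i : ℝ)) = g s := by
    simp only [hg]
    rw [← (Equiv.addLeft m).tsum_eq (fun n => φ (s + fun i => (n i : ℝ)))]
    refine tsum_congr fun n => congrArg φ ?_
    ext i
    simp [add_assoc]
  have hq₀ : IsOpenQuotientMap (Pi.map fun (_ : ι) (x : ℝ) => (x : UnitAddCircle)) :=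
    IsOpenQuotientMap.piMap fun _ => QuotientAddGroup.isOpenQuotientMap_mk
  let q : C(ι → ℝ, UnitAddTorus ι) := ⟨_, hq₀.continuous⟩
  have hq : Topology.IsQuotientMap q := hq₀.isQuotientMap
  have hlift : ∃ F : C(UnitAddTorus ι, ℂ), ∀ s : ι → ℝ,
      F (fun i => (s i : UnitAddCircle)) = g s := by
    have hfac : Function.FactorsThrough g q := by
      intro s t hst
      have : ∀ i, ∃ m : ℤ, t i + m = s i := by
        intro i
        have h1 : ((s i - t i : ℝ) : UnitAddCircle) = 0 := by
          rw [AddCircle.coe_sub, sub_eq_zero]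
          exact congrFun hst i
        obtain ⟨m, hm⟩ := (AddCircle.coe_eq_zero_iff (1 : ℝ)).1 h1
        rw [zsmul_one] at hm
        exact ⟨m, by rw [hm]; ring⟩
      choose m hm using this
      rw [← hgper m t]
      exact congrArg g (funext fun i => (hm i).symm)
    refine ⟨hq.lift ⟨g, hgc⟩ hfac, fun s => ?_⟩
    have := hq.lift_comp ⟨g, hgc⟩ hfac
    exact DFunLike.congr_fun this s
  obtain ⟨F, hF⟩ := hlift
  have hFc (k : ι → ℤ) : UnitAddTorus.mFourierCoeff F k =
      ∫ s, Complex.exp (-(2 * π * Complex.I * ∑ i, (k i : ℂ) * s i)) * φ s := by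
    rw [UnitAddTorus.mFourierCoeff_eq_integral F k 0]
    set e : (ι → ℝ) → ℂ := fun s => Complex.exp (-(2 * π * Complex.I * ∑ i, (k i : ℂ) * s i))
      with he
    have hec : Continuous e := by fun_prop
    have hen (s) : ‖e s‖ = 1 := by
      have : -(2 * π * Complex.I * ∑ i, (k i : ℂ) * s i) =
          ((-(2 * π * ∑ i, (k i : ℝ) * s i) : ℝ) : ℂ) * Complex.I := by push_cast; ring
      rw [he]
      simp only
      rw [this, Complex.norm_exp_ofReal_mul_I]
    have hei : Integrable fun s => e s * φ s :=
      hint.bdd_mul hec.aestronglyMeasurable (Eventually.of_forall fun s => (hen s).le)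
    obtain ⟨u, hu, hle⟩ := hdom 1
    have hcube : volume (unitCube ι) < ⊤ := by
      refine (measure_mono (t := Metric.closedBall 0 1) fun s hs => ?_).trans_lt
        measure_closedBall_lt_top
      exact mem_closedBall_zero_iff.2 (norm_le_one_of_mem_unitCube hs)
    have h1 := (hasSum_setIntegral_unitCube_add_intCast hei).tsum_eq
    rw [← h1]
    have hterm (n : ι → ℤ) : IntegrableOn (fun s => e s * φ (s + fun i => (n i : ℝ)))
        (unitCube ι) := by
      have := (hei.comp_add_right (fun i => (n i : ℝ))).integrableOn (s := unitCube ι)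
      refine this.congr_fun (fun s _ => ?_) (measurableSet_unitCube ι)
      simp only [he, exp_sum_intCast_add]
    have h2 := hasSum_integral_of_summable_integral_norm (μ := volume.restrict (unitCube ι))
      (F := fun (n : ι → ℤ) s => e s * φ (s + fun i => (n i : ℝ))) hterm ?_
    · refine Eq.trans ?_ (h2.tsum_eq.symm.trans (tsum_congr fun n => ?_))
      · refine setIntegral_congr_fun (measurableSet_unitCube ι) fun s _ => ?_
        simp only [mFourier_neg_apply_coe, hF, smul_eq_mul]
        rw [tsum_mul_left]
      · simp only [he, exp_sum_intCast_add]
    · refine Summable.of_nonneg_of_le (fun n => integral_nonneg fun _ => norm_nonneg _)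
        (fun n => ?_) (hu.mul_left (volume.real (unitCube ι)))
      refine (setIntegral_mono_on (hterm n).norm (integrableOn_const hcube.ne)
        (measurableSet_unitCube ι) (g := fun _ => u n) fun s hs => ?_).trans_eq (by simp)
      rw [norm_mul, hen, one_mul]
      exact hle n s (norm_le_one_of_mem_unitCube hs)
  have hs : Summable (UnitAddTorus.mFourierCoeff F) := by
    rw [funext hFc]; exact hcoeff
  have := UnitAddTorus.hasSum_mFourier_series_apply_of_summable hs
    (fun i => ((0 : ι → ℝ) i : UnitAddCircle))
  rw [hF] at this
  simp only [hFc, hg, zero_add] at this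
  refine this.congr_fun fun k => ?_
  simp [UnitAddTorus.mFourier]

/-! ### Lattices and their theta functions -/

theorem Real.pow_mul_exp_sub_sq_le (n : ℕ) (M : ℝ) {c r : ℝ} (hc : 0 < c) (hr : 0 ≤ r) :
    r ^ n * Real.exp (M * r - c * r ^ 2) ≤
      n.factorial * Real.exp ((M + 1) ^ 2 / (4 * c)) := by
  have h1 : r ^ n ≤ n.factorial * Real.exp r := by
    have := Real.pow_div_factorial_le_exp r hr n
    rwa [div_le_iff₀' (by positivity)] at this
  have h2 : r + (M * r - c * r ^ 2) ≤ (M + 1) ^ 2 / (4 * c) := by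
    rw [le_div_iff₀ (by positivity)]
    nlinarith [sq_nonneg (2 * c * r - (M + 1))]
  calc r ^ n * Real.exp (M * r - c * r ^ 2)
      ≤ n.factorial * Real.exp r * Real.exp (M * r - c * r ^ 2) := by gcongr
    _ = n.factorial * Real.exp (r + (M * r - c * r ^ 2)) := by rw [Real.exp_add]; ring
    _ ≤ _ := by gcongr

variable {d : ℕ}

/-- The linear isomorphism `s ↦ A s` from `ℝ^d` to Euclidean space, for `A` invertible. -/
def latticeEquiv (A : Matrix (Fin d) (Fin d) ℝ) (hA : A.det ≠ 0) :
    (Fin d → ℝ) ≃ₗ[ℝ] EuclideanSpace ℝ (Fin d) :=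
  (Matrix.toLinearEquiv' A (A.invertibleOfIsUnitDet hA.isUnit)).trans
    (WithLp.linearEquiv 2 ℝ (Fin d → ℝ)).symm

theorem latticeEquiv_apply {A : Matrix (Fin d) (Fin d) ℝ} (hA : A.det ≠ 0) (s : Fin d → ℝ) :
    latticeEquiv A hA s = WithLp.toLp 2 (A.mulVec s) := rfl

theorem lattice_eq_range {A : Matrix (Fin d) (Fin d) ℝ} (hA : A.det ≠ 0) :
    lattice A = range fun n : Fin d → ℤ => latticeEquiv A hA fun i => (n i : ℝ) := rfl

/-- The lattice is the `ℤ`-span of the columns of `A`, which makes the results on `IsZLattice`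
available. -/
theorem lattice_eq_span {A : Matrix (Fin d) (Fin d) ℝ} (hA : A.det ≠ 0) :
    lattice A = Submodule.span ℤ (range ((Pi.basisFun ℝ (Fin d)).map (latticeEquiv A hA))) := by
  ext z
  rw [lattice_eq_range hA, SetLike.mem_coe, Submodule.mem_span_range_iff_exists_fun]
  refine exists_congr fun n => ?_
  have : (∑ i, n i • ((Pi.basisFun ℝ (Fin d)).map (latticeEquiv A hA)) i) =
      latticeEquiv A hA fun i => (n i : ℝ) := by
    have h : (fun i => (n i : ℝ)) = ∑ i, n i • Pi.basisFun ℝ (Fin d) i := by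
      ext j
      simp [Finset.sum_apply, Pi.single_apply]
    rw [h, map_sum]
    exact Finset.sum_congr rfl fun i _ => by rw [map_zsmul]; rfl
  rw [this]

theorem countable_lattice (A : Matrix (Fin d) (Fin d) ℝ) : (lattice A).Countable :=
  countable_range _

/-- The convergence range of the lattice sum. The summand at `z = x`, if there is one, is `0`. -/
theorem summable_lattice_norm_sub_rpow {A : Matrix (Fin d) (Fin d) ℝ} (hA : A.det ≠ 0)
    (x : EuclideanSpace ℝ (Fin d)) {r : ℝ} (hr : r < -d) :
    Summable fun z : lattice A => ‖z.1 - x‖ ^ r := by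
  have key : Summable fun z : Submodule.span ℤ
      (range ((Pi.basisFun ℝ (Fin d)).map (latticeEquiv A hA))) => ‖z.1 - x‖ ^ r := by
    refine ZLattice.summable_norm_sub_rpow _ r ?_ x
    rw [ZLattice.rank ℝ, finrank_euclideanSpace, Fintype.card_fin]
    exact hr
  rw [lattice_eq_span hA]
  exact key

theorem summable_lattice_exp_sub_sq {A : Matrix (Fin d) (Fin d) ℝ} (hA : A.det ≠ 0)
    (M : ℝ) {c : ℝ} (hc : 0 < c) :
    Summable fun z : lattice A => Real.exp (M * ‖z.1‖ - c * ‖z.1‖ ^ 2) := by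
  have h := (summable_lattice_norm_sub_rpow hA 0 (r := -(d + 1 : ℕ))
    (by push_cast; linarith)).mul_left ((d + 1).factorial * Real.exp ((M + 1) ^ 2 / (4 * c)))
  refine Summable.of_norm_bounded_eventually h ?_
  have hfin : {z : lattice A | z.1 = 0}.Finite :=
    Set.Subsingleton.finite fun a ha b hb => Subtype.ext (ha.trans hb.symm)
  refine hfin.subset fun z hz => ?_
  by_contra hz0
  refine hz ?_
  have hpos : 0 < ‖z.1‖ := norm_pos_iff.2 hz0
  change ‖Real.exp (M * ‖z.1‖ - c * ‖z.1‖ ^ 2)‖ ≤ _ * ‖z.1 - 0‖ ^ (-((d + 1 : ℕ) : ℝ))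
  rw [sub_zero, Real.norm_of_nonneg (Real.exp_pos _).le, Real.rpow_neg hpos.le, Real.rpow_natCast,
    ← div_eq_mul_inv, le_div_iff₀ (by positivity), mul_comm]
  exact Real.pow_mul_exp_sub_sq_le (d + 1) M hc hpos.le

theorem finite_lattice_inter_norm_le {A : Matrix (Fin d) (Fin d) ℝ} (hA : A.det ≠ 0) (R : ℝ) :
    {z | z ∈ lattice A ∧ ‖z‖ ≤ R}.Finite := by
  have h := (summable_lattice_exp_sub_sq hA 0 one_pos).tendsto_cofinite_zero
  have h2 := h.eventually (gt_mem_nhds (Real.exp_pos (-R ^ 2)))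
  have h3 : {z : lattice A | ‖z.1‖ ≤ R}.Finite := by
    refine Set.Finite.subset h2 fun z hz => ?_
    have hz' : ‖z.1‖ ≤ R := hz
    refine not_lt.2 (Real.exp_le_exp.2 ?_)
    have := pow_le_pow_left₀ (norm_nonneg z.1) hz' 2
    linarith
  exact (h3.image Subtype.val).subset fun z hz => ⟨⟨z, hz.1⟩, hz.2, rfl⟩

theorem integral_comp_latticeEquiv {A : Matrix (Fin d) (Fin d) ℝ} (hA : A.det ≠ 0)
    (g : EuclideanSpace ℝ (Fin d) → ℂ) :
    ∫ s, g (latticeEquiv A hA s) = ((|A.det|⁻¹ : ℝ) : ℂ) * ∫ v, g v := by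
  have hemb : MeasurableEmbedding (Matrix.toLin' A) := by
    refine (LinearMap.isClosedEmbedding_of_injective ?_).measurableEmbedding
    exact LinearMap.ker_eq_bot.2
      (Matrix.toLinearEquiv' A (A.invertibleOfIsUnitDet hA.isUnit)).injective
  have h1 := hemb.integral_map (μ := volume) (fun s => g (WithLp.toLp 2 s))
  rw [Real.map_matrix_volume_pi_eq_smul_volume_pi hA, integral_smul_measure,
    (PiLp.volume_preserving_toLp (Fin d)).integral_comp
      (MeasurableEquiv.toLp 2 _).measurableEmbedding,
    ENNReal.toReal_ofReal (abs_nonneg _), abs_inv] at h1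
  rw [← Complex.real_smul, h1]
  rfl

theorem integrable_comp_latticeEquiv {A : Matrix (Fin d) (Fin d) ℝ} (hA : A.det ≠ 0)
    {g : EuclideanSpace ℝ (Fin d) → ℂ} (hg : Integrable g) :
    Integrable fun s => g (latticeEquiv A hA s) := by
  have hemb : MeasurableEmbedding (Matrix.toLin' A) := by
    refine (LinearMap.isClosedEmbedding_of_injective ?_).measurableEmbedding
    exact LinearMap.ker_eq_bot.2
      (Matrix.toLinearEquiv' A (A.invertibleOfIsUnitDet hA.isUnit)).injective
  have h1 := hemb.integrable_map_iff (μ := volume) (g := fun s => g (WithLp.toLp 2 s))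
  rw [Real.map_matrix_volume_pi_eq_smul_volume_pi hA] at h1
  refine h1.1 (Integrable.smul_measure ?_ ENNReal.ofReal_ne_top)
  exact ((PiLp.volume_preserving_toLp (Fin d)).integrable_comp_emb
      (MeasurableEquiv.toLp 2 _).measurableEmbedding).2 hg

theorem det_transpose_inv_ne_zero {A : Matrix (Fin d) (Fin d) ℝ} (hA : A.det ≠ 0) :
    (A⁻¹).transpose.det ≠ 0 := by
  rw [Matrix.det_transpose, Matrix.det_nonsing_inv]
  simpa using hA

/-- `A^{-T}` is dual to `A`: `⟪A^{-T} k, A s⟫ = k · s`. -/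
theorem inner_latticeEquiv_dual {A : Matrix (Fin d) (Fin d) ℝ} (hA : A.det ≠ 0)
    (k s : Fin d → ℝ) :
    inner ℝ (latticeEquiv (A⁻¹).transpose (det_transpose_inv_ne_zero hA) k) (latticeEquiv A hA s) =
      ∑ i, k i * s i := by
  rw [latticeEquiv_apply, latticeEquiv_apply, EuclideanSpace.inner_toLp_toLp]
  simp only [star_trivial]
  rw [Matrix.mulVec_transpose, dotProduct_comm, ← Matrix.dotProduct_mulVec, Matrix.mulVec_mulVec,
    Matrix.nonsing_inv_mul _ hA.isUnit, Matrix.one_mulVec]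
  rfl

theorem injective_latticeEquiv_intCast {A : Matrix (Fin d) (Fin d) ℝ} (hA : A.det ≠ 0) :
    Function.Injective fun n : Fin d → ℤ => latticeEquiv A hA fun i => (n i : ℝ) := by
  intro m n h
  have := (latticeEquiv A hA).injective h
  exact funext fun i => by exact_mod_cast congrFun this i

/-- The coordinates `ℤ^d ≃ Λ` given by the columns of `A`. -/
def intEquivLattice (A : Matrix (Fin d) (Fin d) ℝ) (hA : A.det ≠ 0) :
    (Fin d → ℤ) ≃ lattice A :=
  Equiv.ofInjective _ (injective_latticeEquiv_intCast hA)

theorem coe_intEquivLattice {A : Matrix (Fin d) (Fin d) ℝ} (hA : A.det ≠ 0) (n : Fin d → ℤ) :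
    (intEquivLattice A hA n : EuclideanSpace ℝ (Fin d)) = latticeEquiv A hA fun i => (n i : ℝ) :=
  rfl

/-- The term `exp (-2πi y·z) exp (-π t |x - z|²)` of the theta function. -/
def thetaTerm (x y : EuclideanSpace ℝ (Fin d)) (t : ℝ) (z : EuclideanSpace ℝ (Fin d)) : ℂ :=
  Complex.exp (-2 * π * Complex.I * (inner ℝ y z : ℝ)) * (Real.exp (-(π * ‖x - z‖ ^ 2) * t) : ℝ)

theorem norm_cexp_neg_two_pi_I_mul_ofReal (a : ℝ) :
    ‖Complex.exp (-2 * π * Complex.I * a)‖ = 1 := by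
  rw [show -2 * π * Complex.I * a = ((-2 * π * a : ℝ) : ℂ) * Complex.I by push_cast; ring,
    Complex.norm_exp_ofReal_mul_I]

theorem norm_thetaTerm (x y : EuclideanSpace ℝ (Fin d)) (t : ℝ) (z : EuclideanSpace ℝ (Fin d)) :
    ‖thetaTerm x y t z‖ = Real.exp (-(π * ‖x - z‖ ^ 2) * t) := by
  rw [thetaTerm, norm_mul, norm_cexp_neg_two_pi_I_mul_ofReal, one_mul, Complex.norm_real,
    Real.norm_of_nonneg (Real.exp_pos _).le]

theorem continuous_thetaTerm (x y : EuclideanSpace ℝ (Fin d)) (t : ℝ) :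
    Continuous (thetaTerm x y t) := by
  unfold thetaTerm
  fun_prop

theorem sq_sub_two_mul_le {a b M : ℝ} (ha : 0 ≤ a) (hM : 0 ≤ M) (hb : 0 ≤ b) (h : b ≤ a + M) :
    b ^ 2 - 2 * M * b ≤ a ^ 2 := by
  rcases le_total M b with h1 | h1
  · nlinarith
  · nlinarith

/-- A Gaussian bound that is uniform in the bounded shift `v`. -/
theorem norm_thetaTerm_add_le {x v : EuclideanSpace ℝ (Fin d)} (y : EuclideanSpace ℝ (Fin d))
    {t M : ℝ} (ht : 0 < t) (hM : ‖x - v‖ ≤ M) (z : EuclideanSpace ℝ (Fin d)) :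
    ‖thetaTerm x y t (v + z)‖ ≤ Real.exp (2 * π * t * M * ‖z‖ - π * t * ‖z‖ ^ 2) := by
  rw [norm_thetaTerm]
  refine Real.exp_le_exp.2 ?_
  have h1 : ‖z‖ ≤ ‖x - (v + z)‖ + M := by
    have : z = (x - v) - (x - (v + z)) := by abel
    calc ‖z‖ = ‖(x - v) - (x - (v + z))‖ := by rw [← this]
      _ ≤ ‖x - v‖ + ‖x - (v + z)‖ := norm_sub_le _ _
      _ ≤ _ := by linarith
  have h2 := sq_sub_two_mul_le (norm_nonneg _) ((norm_nonneg _).trans hM) (norm_nonneg z) h1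
  have h3 := mul_le_mul_of_nonneg_left h2 (mul_pos Real.pi_pos ht).le
  linarith

/-- The Fourier integral of a theta term: up to a factor, it is the theta term at `1 / t` with the
roles of `x` and `y` interchanged. -/
theorem integral_thetaTerm (x y k : EuclideanSpace ℝ (Fin d)) {t : ℝ} (ht : 0 < t) :
    Integrable (thetaTerm x (y + k) t) ∧ ∫ v, thetaTerm x (y + k) t v =
      ((t⁻¹ : ℝ) : ℂ) ^ (d / 2 : ℂ) * Complex.exp (-2 * π * Complex.I * (inner ℝ x y : ℝ)) *
        thetaTerm y (-x) t⁻¹ (-k) := by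
  have hb : 0 < ((π * t : ℝ) : ℂ).re := by
    rw [Complex.ofReal_re]; exact mul_pos Real.pi_pos ht
  have hfun : (fun v => thetaTerm x (y + k) t (x + v)) = fun v =>
      Complex.exp (-2 * π * Complex.I * (inner ℝ (y + k) x : ℝ)) *
        Complex.exp (-((π * t : ℝ) : ℂ) * ‖v‖ ^ 2 +
          (-2 * π * Complex.I) * (inner ℝ (y + k) v : ℝ)) := by
    ext v
    rw [thetaTerm, inner_add_right, sub_add_cancel_left, norm_neg, Complex.ofReal_exp,
      ← Complex.exp_add, ← Complex.exp_add]
    congr 1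
    push_cast
    ring
  have hint := (GaussianFourier.integrable_cexp_neg_mul_sq_norm_add hb (-2 * π * Complex.I)
    (y + k)).const_mul (Complex.exp (-2 * π * Complex.I * (inner ℝ (y + k) x : ℝ)))
  rw [← hfun] at hint
  refine ⟨?_, ?_⟩
  · have := hint.comp_add_left (-x)
    simpa using this
  · rw [← integral_add_left_eq_self (thetaTerm x (y + k) t) x, hfun, integral_const_mul,
      GaussianFourier.integral_cexp_neg_mul_sq_norm_add hb, finrank_euclideanSpace,
      Fintype.card_fin]
    have h1 : (π : ℂ) / ((π * t : ℝ) : ℂ) = ((t⁻¹ : ℝ) : ℂ) := by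
      have hπ : (π : ℂ) ≠ 0 := Complex.ofReal_ne_zero.2 Real.pi_ne_zero
      have ht' : (t : ℂ) ≠ 0 := Complex.ofReal_ne_zero.2 ht.ne'
      push_cast
      field_simp
    rw [h1, mul_left_comm, ← Complex.exp_add, thetaTerm, Complex.ofReal_exp,
      ← Complex.exp_add, mul_assoc (((t⁻¹ : ℝ) : ℂ) ^ (d / 2 : ℂ)),
      ← Complex.exp_add, sub_neg_eq_add, inner_add_left, inner_neg_neg,
      real_inner_comm x y, real_inner_comm x k]
    congr 2
    have hπ : (π : ℂ) ≠ 0 := Complex.ofReal_ne_zero.2 Real.pi_ne_zero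
    have ht' : (t : ℂ) ≠ 0 := Complex.ofReal_ne_zero.2 ht.ne'
    push_cast
    field_simp
    ring_nf
    rw [Complex.I_sq]
    ring

theorem summable_thetaTerm {A : Matrix (Fin d) (Fin d) ℝ} (hA : A.det ≠ 0)
    {P : Set (EuclideanSpace ℝ (Fin d))} (hP : P ⊆ lattice A)
    (x y : EuclideanSpace ℝ (Fin d)) {t : ℝ} (ht : 0 < t) :
    Summable fun z : P => thetaTerm x y t z := by
  refine Summable.of_norm_bounded ((summable_lattice_exp_sub_sq hA (2 * π * t * ‖x - 0‖)
    (mul_pos Real.pi_pos ht)).comp_injective (Set.inclusion_injective hP)) fun q => ?_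
  have := norm_thetaTerm_add_le (x := x) y ht (le_refl ‖x - 0‖) q.1
  rwa [zero_add] at this

/-- The transformation formula of the theta function of a lattice. -/
theorem tsum_lattice_thetaTerm {A : Matrix (Fin d) (Fin d) ℝ} (hA : A.det ≠ 0)
    (x y : EuclideanSpace ℝ (Fin d)) {t : ℝ} (ht : 0 < t) :
    ∑' z : lattice A, thetaTerm x y t z =
      ((|A.det|⁻¹ : ℝ) : ℂ) * (((t⁻¹ : ℝ) : ℂ) ^ (d / 2 : ℂ) *
        Complex.exp (-2 * π * Complex.I * (inner ℝ x y : ℝ)) *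
        ∑' q : reciprocalLattice A, thetaTerm y (-x) t⁻¹ q) := by
  have hB := det_transpose_inv_ne_zero hA
  have hsumm : Summable fun q : reciprocalLattice A => thetaTerm y (-x) t⁻¹ q :=
    summable_thetaTerm hB subset_rfl y (-x) (inv_pos.2 ht)
  have hcoeff (k : Fin d → ℤ) :
      ∫ s, Complex.exp (-(2 * π * Complex.I * ∑ i, (k i : ℂ) * s i)) *
        thetaTerm x y t (latticeEquiv A hA s) =
      ((|A.det|⁻¹ : ℝ) : ℂ) * (((t⁻¹ : ℝ) : ℂ) ^ (d / 2 : ℂ) *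
        Complex.exp (-2 * π * Complex.I * (inner ℝ x y : ℝ)) *
        thetaTerm y (-x) t⁻¹ (intEquivLattice _ hB (-k))) := by
    rw [coe_intEquivLattice]
    have hneg : (latticeEquiv _ hB fun i => ((-k) i : ℝ)) =
        -latticeEquiv _ hB fun i => (k i : ℝ) := by
      rw [← map_neg]
      congr 1
      ext i
      simp
    rw [hneg, ← (integral_thetaTerm x y _ ht).2, ← integral_comp_latticeEquiv hA]
    refine integral_congr_ae (Eventually.of_forall fun s => ?_)
    simp only [thetaTerm]
    rw [inner_add_left, inner_latticeEquiv_dual hA, ← mul_assoc, ← Complex.exp_add]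
    congr 2
    push_cast
    ring
  -- the dual point attached to the frequency `k` is `q = -A^{-T} k`
  have hsumm' := hsumm.comp_injective
    ((Equiv.neg (Fin d → ℤ)).trans (intEquivLattice _ hB)).injective
  have hpoisson := hasSum_integral_exp_mul_eq_tsum_intCast
    (φ := fun s => thetaTerm x y t (latticeEquiv A hA s))
    ((continuous_thetaTerm x y t).comp
      (LinearMap.continuous_of_finiteDimensional (latticeEquiv A hA).toLinearMap))
    (integrable_comp_latticeEquiv hA (by
      simpa using (integral_thetaTerm x y 0 ht).1)) ?_ ?_
  · rw [← (intEquivLattice A hA).tsum_eq]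
    refine hpoisson.tsum_eq.symm.trans ?_
    simp_rw [hcoeff]
    rw [tsum_mul_left, tsum_mul_left]
    congr 2
    exact ((Equiv.neg (Fin d → ℤ)).trans (intEquivLattice _ hB)).tsum_eq
      (fun q => thetaTerm y (-x) t⁻¹ q.1)
  · intro R
    let T : (Fin d → ℝ) →L[ℝ] EuclideanSpace ℝ (Fin d) :=
      LinearMap.toContinuousLinearMap (latticeEquiv A hA).toLinearMap
    refine ⟨_, (summable_lattice_exp_sub_sq hA (2 * π * t * (‖x‖ + ‖T‖ * R))
      (mul_pos Real.pi_pos ht)).comp_injective (intEquivLattice A hA).injective,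
      fun n s hs => ?_⟩
    simp only [map_add]
    refine norm_thetaTerm_add_le y ht ?_ _
    refine (norm_sub_le _ _).trans ?_
    gcongr
    exact (T.le_opNorm s).trans (by gcongr)
  · simp_rw [hcoeff]
    exact (hsumm'.mul_left _).mul_left _

/-! ### Truncated Mellin integrals at complex vectors -/

/-- The bilinear (not sesquilinear) dot product on `ℂ^d`. -/
def bilin (u w : EuclideanSpace ℂ (Fin d)) : ℂ := ∑ i, u i * w i

theorem differentiable_bilin {E : Type*} [NormedAddCommGroup E] [NormedSpace ℂ E]
    {f g : E → EuclideanSpace ℂ (Fin d)} (hf : Differentiable ℂ f) (hg : Differentiable ℂ g) :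
    Differentiable ℂ fun p => bilin (f p) (g p) := by
  unfold bilin
  fun_prop

theorem bilin_toComplexVec (x y : EuclideanSpace ℝ (Fin d)) :
    bilin (toComplexVec x) (toComplexVec y) = (inner ℝ x y : ℝ) := by
  simp [bilin, toComplexVec, PiLp.inner_apply, mul_comm]

theorem bilin_sub_self_toComplexVec (x z : EuclideanSpace ℝ (Fin d)) :
    bilin (toComplexVec x - toComplexVec z) (toComplexVec x - toComplexVec z) =
      ((‖x - z‖ ^ 2 : ℝ) : ℂ) := by
  have : toComplexVec x - toComplexVec z = toComplexVec (x - z) := by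
    ext i
    simp [toComplexVec]
  rw [this, bilin_toComplexVec, real_inner_self_eq_norm_sq]

theorem norm_sq_eq_reVec_add_imVec (u : EuclideanSpace ℂ (Fin d)) :
    ‖u‖ ^ 2 = ‖reVec u‖ ^ 2 + ‖imVec u‖ ^ 2 := by
  rw [EuclideanSpace.norm_sq_eq, EuclideanSpace.norm_sq_eq, EuclideanSpace.norm_sq_eq,
    ← Finset.sum_add_distrib]
  refine Finset.sum_congr rfl fun i _ => ?_
  simp only [reVec, imVec, Real.norm_eq_abs, sq_abs]
  rw [← Complex.normSq_eq_norm_sq, Complex.normSq_apply]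
  ring

theorem norm_reVec_le (u : EuclideanSpace ℂ (Fin d)) : ‖reVec u‖ ≤ ‖u‖ := by
  have := norm_sq_eq_reVec_add_imVec u
  exact (sq_le_sq₀ (norm_nonneg _) (norm_nonneg _)).1 (by nlinarith [sq_nonneg ‖imVec u‖])

theorem norm_imVec_le (u : EuclideanSpace ℂ (Fin d)) : ‖imVec u‖ ≤ ‖u‖ := by
  have := norm_sq_eq_reVec_add_imVec u
  exact (sq_le_sq₀ (norm_nonneg _) (norm_nonneg _)).1 (by nlinarith [sq_nonneg ‖reVec u‖])

theorem continuous_reVec : Continuous (reVec : EuclideanSpace ℂ (Fin d) → _) := by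
  unfold reVec
  fun_prop

theorem continuous_imVec : Continuous (imVec : EuclideanSpace ℂ (Fin d) → _) := by
  unfold imVec
  fun_prop

theorem re_bilin_sub_self (u : EuclideanSpace ℂ (Fin d)) (z : EuclideanSpace ℝ (Fin d)) :
    (bilin (u - toComplexVec z) (u - toComplexVec z)).re =
      ‖reVec u - z‖ ^ 2 - ‖imVec u‖ ^ 2 := by
  rw [EuclideanSpace.norm_sq_eq, EuclideanSpace.norm_sq_eq, ← Finset.sum_sub_distrib, bilin,
    Complex.re_sum]
  refine Finset.sum_congr rfl fun i _ => ?_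
  simp [reVec, imVec, toComplexVec, Real.norm_eq_abs, sq_abs]
  ring

theorem norm_cexp_bilin_toComplexVec_le (w : EuclideanSpace ℂ (Fin d))
    (z : EuclideanSpace ℝ (Fin d)) :
    ‖Complex.exp (-2 * π * Complex.I * bilin w (toComplexVec z))‖ ≤
      Real.exp (2 * π * ‖w‖ * ‖z‖) := by
  rw [Complex.norm_exp]
  refine Real.exp_le_exp.2 ?_
  have h1 : (bilin w (toComplexVec z)).im = inner ℝ (imVec w) z := by
    simp [bilin, toComplexVec, imVec, PiLp.inner_apply, mul_comm]
  have h2 : (-2 * π * Complex.I * bilin w (toComplexVec z)).re =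
      2 * π * inner ℝ (imVec w) z := by
    rw [← h1]
    simp
  rw [h2, mul_assoc (2 * π)]
  refine mul_le_mul_of_nonneg_left ?_ Real.two_pi_pos.le
  exact (real_inner_le_norm _ _).trans (by gcongr; exact norm_imVec_le w)

/-- Near a point of the cone domain, the real part of `(u - z)²` grows quadratically in `z`,
uniformly in `u`: for large `z` because `u` stays bounded, and the remaining `z` are finitely many. -/
theorem exists_forall_mul_le_of_mem_coneDomain {A : Matrix (Fin d) (Fin d) ℝ} (hA : A.det ≠ 0)
    {P : Set (EuclideanSpace ℝ (Fin d))} (hP : P ⊆ lattice A) {u₀ : EuclideanSpace ℂ (Fin d)}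
    (hu₀ : u₀ ∈ coneDomain P) :
    ∃ c > 0, ∀ᶠ u in 𝓝 u₀, ∀ z ∈ P,
      c * (1 + ‖z‖ ^ 2) ≤ ‖reVec u - z‖ ^ 2 - ‖imVec u‖ ^ 2 := by
  set M : ℝ := ‖u₀‖ + 1 with hM
  have hM1 : 1 ≤ M := by linarith [norm_nonneg u₀]
  set N : Set (EuclideanSpace ℝ (Fin d)) := {z | z ∈ P ∧ ‖z‖ ≤ 4 * M} with hN
  have hNfin : N.Finite :=
    (finite_lattice_inter_norm_le hA (4 * M)).subset fun z hz => ⟨hP hz.1, hz.2⟩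
  -- for each of the finitely many small `z`, a joint limit as `u → u₀` and `c → 0` provides `c`
  have hnear : ∀ᶠ a : EuclideanSpace ℂ (Fin d) × ℝ in 𝓝 u₀ ×ˢ 𝓝 0, ∀ z ∈ N,
      a.2 * (1 + ‖z‖ ^ 2) ≤ ‖reVec a.1 - z‖ ^ 2 - ‖imVec a.1‖ ^ 2 := by
    rw [← nhds_prod_eq, hNfin.eventually_all]
    intro z hz
    have hpos : (0 : ℝ) * (1 + ‖z‖ ^ 2) < ‖reVec u₀ - z‖ ^ 2 - ‖imVec u₀‖ ^ 2 := by
      rw [zero_mul, sub_pos]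
      exact pow_lt_pow_left₀ (hu₀ z hz.1) (norm_nonneg _) two_ne_zero
    have hc1 : Continuous fun a : EuclideanSpace ℂ (Fin d) × ℝ => a.2 * (1 + ‖z‖ ^ 2) := by fun_prop
    have hc2 : Continuous fun a : EuclideanSpace ℂ (Fin d) × ℝ =>
        ‖reVec a.1 - z‖ ^ 2 - ‖imVec a.1‖ ^ 2 := by
      have := (continuous_reVec (d := d)).comp (continuous_fst (Y := ℝ))
      have := (continuous_imVec (d := d)).comp (continuous_fst (Y := ℝ))
      simp only [Function.comp_def] at *
      fun_prop
    exact (hc1.continuousAt.eventually_lt hc2.continuousAt hpos).mono fun a ha => ha.le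
  obtain ⟨p, hp, q, hq, hpq⟩ := eventually_prod_iff.1 hnear
  obtain ⟨ε, hε, hεq⟩ := Metric.eventually_nhds_iff.1 hq
  -- `ε / 2` serves the `z` with `|z| ≤ 4 M`, and `1 / 4` all larger ones
  refine ⟨min (ε / 2) (1 / 4), by positivity, ?_⟩
  filter_upwards [hp, Metric.ball_mem_nhds u₀ one_pos] with u hu hub z hz
  by_cases hzM : ‖z‖ ≤ 4 * M
  · refine hpq hu (hεq ?_) z ⟨hz, hzM⟩
    rw [Real.dist_eq, sub_zero, abs_of_nonneg (by positivity)]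
    exact (min_le_left _ _).trans_lt (by linarith)
  · have huM : ‖u‖ ≤ M := by
      have h1 := norm_le_norm_add_norm_sub' u u₀
      have h2 := mem_ball_iff_norm.1 hub
      linarith
    have h1 : ‖z‖ ≤ ‖reVec u - z‖ + M := by
      have := norm_sub_norm_le z (reVec u)
      rw [norm_sub_rev] at this
      linarith [norm_reVec_le u]
    have h2 := sq_sub_two_mul_le (norm_nonneg _) (by linarith) (norm_nonneg z) h1
    have h3 : ‖imVec u‖ ^ 2 ≤ M ^ 2 :=
      pow_le_pow_left₀ (norm_nonneg _) ((norm_imVec_le u).trans huM) 2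
    have h4 : min (ε / 2) (1 / 4) * (1 + ‖z‖ ^ 2) ≤ 1 / 4 * (1 + ‖z‖ ^ 2) := by
      gcongr
      exact min_le_right _ _
    nlinarith

theorem isOpen_coneDomain {A : Matrix (Fin d) (Fin d) ℝ} (hA : A.det ≠ 0)
    {P : Set (EuclideanSpace ℝ (Fin d))} (hP : P ⊆ lattice A) : IsOpen (coneDomain P) := by
  rw [isOpen_iff_mem_nhds]
  intro u hu
  obtain ⟨c, hc, h⟩ := exists_forall_mul_le_of_mem_coneDomain hA hP hu
  filter_upwards [h] with v hv z hz
  have h1 : 0 < c * (1 + ‖z‖ ^ 2) := by positivity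
  exact (sq_lt_sq₀ (norm_nonneg _) (norm_nonneg _)).1 (by linarith [hv z hz])

/-- The term `t ^ (s - 1) exp (-2πi w·z) exp (-π t (u - z)²)`, as a holomorphic function of
`p = (s, u, w)`. -/
def thetaKernel (p : ℂ × EuclideanSpace ℂ (Fin d) × EuclideanSpace ℂ (Fin d)) (t : ℝ)
    (z : EuclideanSpace ℝ (Fin d)) : ℂ :=
  (t : ℂ) ^ (p.1 - 1) * (Complex.exp (-2 * π * Complex.I * bilin p.2.2 (toComplexVec z)) *
    Complex.exp (-(π * bilin (p.2.1 - toComplexVec z) (p.2.1 - toComplexVec z)) * t))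

theorem thetaKernel_toComplexVec (s : ℂ) (x y : EuclideanSpace ℝ (Fin d)) (t : ℝ)
    (z : EuclideanSpace ℝ (Fin d)) :
    thetaKernel (s, toComplexVec x, toComplexVec y) t z =
      (t : ℂ) ^ (s - 1) * thetaTerm x y t z := by
  rw [thetaKernel, thetaTerm, bilin_toComplexVec, bilin_sub_self_toComplexVec]
  push_cast
  rfl

/-- The part over `(1, ∞)` of the Mellin transform of a theta sum,
`∫_1^∞ t ^ (s - 1) ∑_{z ∈ P} exp (-2πi w·z) exp (-π t (u - z)²) dt`, at `p = (s, u, w)`. The sum is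
written as an integral with respect to the counting measure on `P`. -/
def thetaMellin (P : Set (EuclideanSpace ℝ (Fin d)))
    (p : ℂ × EuclideanSpace ℂ (Fin d) × EuclideanSpace ℂ (Fin d)) : ℂ :=
  ∫ a : ℝ × P, thetaKernel p a.1 a.2 ∂((volume.restrict (Ioi 1)).prod Measure.count)

theorem differentiable_thetaKernel {t : ℝ} (ht : t ≠ 0) (z : EuclideanSpace ℝ (Fin d)) :
    Differentiable ℂ fun p => thetaKernel p t z := by
  unfold thetaKernel
  have h1 : Differentiable ℂ
      fun p : ℂ × EuclideanSpace ℂ (Fin d) × EuclideanSpace ℂ (Fin d) => (t : ℂ) ^ (p.1 - 1) := by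
    intro p
    exact (by fun_prop : DifferentiableAt ℂ (fun p : ℂ × EuclideanSpace ℂ (Fin d) ×
      EuclideanSpace ℂ (Fin d) => p.1 - 1) p).const_cpow (Or.inl (Complex.ofReal_ne_zero.2 ht))
  have h2 : Differentiable ℂ fun p : ℂ × EuclideanSpace ℂ (Fin d) × EuclideanSpace ℂ (Fin d) =>
      bilin p.2.2 (toComplexVec z) := differentiable_bilin (by fun_prop) (by fun_prop)
  have h3 : Differentiable ℂ fun p : ℂ × EuclideanSpace ℂ (Fin d) × EuclideanSpace ℂ (Fin d) =>
      bilin (p.2.1 - toComplexVec z) (p.2.1 - toComplexVec z) :=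
    differentiable_bilin (by fun_prop) (by fun_prop)
  fun_prop

theorem aestronglyMeasurable_thetaKernel {P : Set (EuclideanSpace ℝ (Fin d))} (hP : P.Countable)
    (p : ℂ × EuclideanSpace ℂ (Fin d) × EuclideanSpace ℂ (Fin d)) :
    AEStronglyMeasurable (fun a : ℝ × P => thetaKernel p a.1 a.2)
      ((volume.restrict (Ioi 1)).prod Measure.count) := by
  have := hP.to_subtype
  refine Measurable.aestronglyMeasurable (measurable_from_prod_countable_left fun z => ?_)
  simp only [thetaKernel]
  generalize bilin p.2.2 (toComplexVec z) = b₁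
  generalize bilin (p.2.1 - toComplexVec z) (p.2.1 - toComplexVec z) = b₂
  fun_prop

/-- The majorant is a product of a function of `t` and a function of `z`, as
`t (1 + |z|²) ≥ t + |z|²` for `t ≥ 1`. -/
theorem exists_integrable_forall_norm_thetaKernel_le {A : Matrix (Fin d) (Fin d) ℝ}
    (hA : A.det ≠ 0) {P : Set (EuclideanSpace ℝ (Fin d))} (hP : P ⊆ lattice A)
    {p₀ : ℂ × EuclideanSpace ℂ (Fin d) × EuclideanSpace ℂ (Fin d)}
    (hp₀ : p₀.2.1 ∈ coneDomain P) :
    ∃ V ∈ 𝓝 p₀, ∃ bound : ℝ × P → ℝ,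
      Integrable bound ((volume.restrict (Ioi 1)).prod Measure.count) ∧
      ∀ᵐ a ∂((volume.restrict (Ioi (1 : ℝ))).prod (Measure.count : Measure P)),
        ∀ p ∈ V, ‖thetaKernel p a.1 a.2‖ ≤ bound a := by
  have := ((countable_lattice A).mono hP).to_subtype
  obtain ⟨c, hc, hcone⟩ := exists_forall_mul_le_of_mem_coneDomain hA hP hp₀
  set S : ℝ := ‖p₀.1‖ + 1
  set W : ℝ := ‖p₀.2.2‖ + 1
  have hV : ∀ᶠ p in 𝓝 p₀, ‖p.1‖ ≤ S ∧ ‖p.2.2‖ ≤ W ∧ ∀ z ∈ P,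
      c * (1 + ‖z‖ ^ 2) ≤ ‖reVec p.2.1 - z‖ ^ 2 - ‖imVec p.2.1‖ ^ 2 := by
    have h1 : ∀ᶠ p in 𝓝 p₀, ‖p.1‖ < S :=
      (by fun_prop : ContinuousAt (fun p : ℂ × EuclideanSpace ℂ (Fin d) ×
        EuclideanSpace ℂ (Fin d) => ‖p.1‖) p₀).eventually_lt_const (lt_add_one _)
    have h2 : ∀ᶠ p in 𝓝 p₀, ‖p.2.2‖ < W :=
      (by fun_prop : ContinuousAt (fun p : ℂ × EuclideanSpace ℂ (Fin d) ×
        EuclideanSpace ℂ (Fin d) => ‖p.2.2‖) p₀).eventually_lt_const (lt_add_one _)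
    have h3 := (by fun_prop : ContinuousAt (fun p : ℂ × EuclideanSpace ℂ (Fin d) ×
        EuclideanSpace ℂ (Fin d) => p.2.1) p₀).eventually hcone
    filter_upwards [h1, h2, h3] with p a b c using ⟨a.le, b.le, c⟩
  have hπc : 0 < π * c := by positivity
  refine ⟨_, hV, fun a => (a.1 ^ S * Real.exp (-(π * c) * a.1)) *
    Real.exp (2 * π * W * ‖a.2.1‖ - π * c * ‖a.2.1‖ ^ 2), ?_, ?_⟩
  · refine Integrable.mul_prod (f := fun t : ℝ => t ^ S * Real.exp (-(π * c) * t))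
      (g := fun z : P => Real.exp (2 * π * W * ‖z.1‖ - π * c * ‖z.1‖ ^ 2)) ?_ ?_
    · have hS : -1 < S := by linarith [norm_nonneg p₀.1]
      have h := (integrableOn_rpow_mul_exp_neg_mul_rpow hS one_pos hπc).mono_set
        (Ioi_subset_Ioi zero_le_one)
      simp only [Real.rpow_one] at h
      exact h
    · rw [integrable_count_iff]
      exact ((summable_lattice_exp_sub_sq hA (2 * π * W) hπc).comp_injective
        (Set.inclusion_injective hP)).norm
  · have hfst : ∀ᵐ a ∂((volume.restrict (Ioi (1 : ℝ))).prod (Measure.count : Measure P)),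
        a.1 ∈ Ioi (1 : ℝ) :=
      Measure.quasiMeasurePreserving_fst.ae (ae_restrict_mem measurableSet_Ioi)
    filter_upwards [hfst] with a ha p hp
    obtain ⟨hs, hw, hu⟩ := hp
    have ht : 1 < a.1 := ha
    have ht0 : 0 < a.1 := by linarith
    rw [thetaKernel, norm_mul, norm_mul, Complex.norm_cpow_eq_rpow_re_of_pos ht0]
    have h1 : a.1 ^ (p.1 - 1).re ≤ a.1 ^ S := by
      refine Real.rpow_le_rpow_of_exponent_le ht.le ?_
      have := (Complex.re_le_norm p.1).trans hs
      simp
      linarith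
    have h2 : ‖Complex.exp (-2 * π * Complex.I * bilin p.2.2 (toComplexVec a.2.1))‖ ≤
        Real.exp (2 * π * W * ‖a.2.1‖) := by
      refine (norm_cexp_bilin_toComplexVec_le _ _).trans (Real.exp_le_exp.2 ?_)
      gcongr
    have h3 : ‖Complex.exp (-(π * bilin (p.2.1 - toComplexVec a.2.1)
        (p.2.1 - toComplexVec a.2.1)) * a.1)‖ ≤
        Real.exp (-(π * c) * a.1 - π * c * ‖a.2.1‖ ^ 2) := by
      rw [Complex.norm_exp]
      refine Real.exp_le_exp.2 ?_
      rw [Complex.re_mul_ofReal, Complex.neg_re, Complex.re_ofReal_mul, re_bilin_sub_self]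
      have h4 := hu a.2.1 a.2.2
      have h5 : c * (1 + ‖a.2.1‖ ^ 2) * a.1 ≥ c * (a.1 + ‖a.2.1‖ ^ 2) := by
        have : 0 ≤ c * (‖a.2.1‖ ^ 2 * (a.1 - 1)) :=
          mul_nonneg hc.le (mul_nonneg (sq_nonneg _) (by linarith))
        linarith
      have h6 := mul_le_mul_of_nonneg_right h4 ht0.le
      have h7 := mul_le_mul_of_nonneg_left (h5.le.trans h6) Real.pi_pos.le
      linarith
    calc _ ≤ a.1 ^ S * (Real.exp (2 * π * W * ‖a.2.1‖) *
          Real.exp (-(π * c) * a.1 - π * c * ‖a.2.1‖ ^ 2)) := by gcongr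
      _ = _ := by
        rw [mul_assoc (a.1 ^ S), ← Real.exp_add, ← Real.exp_add]
        congr 2
        ring

theorem differentiableOn_thetaMellin {A : Matrix (Fin d) (Fin d) ℝ} (hA : A.det ≠ 0)
    {P : Set (EuclideanSpace ℝ (Fin d))} (hP : P ⊆ lattice A) :
    DifferentiableOn ℂ (thetaMellin P) (univ ×ˢ (coneDomain P ×ˢ univ)) := by
  have hPc := (countable_lattice A).mono hP
  have := hPc.to_subtype
  refine differentiableOn_integral_of_locally_dominated
    (isOpen_univ.prod ((isOpen_coneDomain hA hP).prod isOpen_univ))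
    (fun p _ => aestronglyMeasurable_thetaKernel hPc p) ?_
    fun p hp => exists_integrable_forall_norm_thetaKernel_le hA hP hp.2.1
  -- the kernel is holomorphic in `s` only for `t ≠ 0`, which holds almost everywhere on `(1, ∞)`
  filter_upwards [Measure.quasiMeasurePreserving_fst.ae (ae_restrict_mem measurableSet_Ioi)]
    with a ha
  exact (differentiable_thetaKernel (zero_lt_one.trans ha).ne' a.2.1).differentiableOn

theorem integrable_thetaKernel {A : Matrix (Fin d) (Fin d) ℝ} (hA : A.det ≠ 0)
    {P : Set (EuclideanSpace ℝ (Fin d))} (hP : P ⊆ lattice A)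
    {p : ℂ × EuclideanSpace ℂ (Fin d) × EuclideanSpace ℂ (Fin d)} (hp : p.2.1 ∈ coneDomain P) :
    Integrable (fun a : ℝ × P => thetaKernel p a.1 a.2)
      ((volume.restrict (Ioi 1)).prod Measure.count) := by
  obtain ⟨V, hV, bound, hbound, hle⟩ := exists_integrable_forall_norm_thetaKernel_le hA hP hp
  exact hbound.mono' (aestronglyMeasurable_thetaKernel ((countable_lattice A).mono hP) p)
    (hle.mono fun a ha => ha p (mem_of_mem_nhds hV))

theorem toComplexVec_mem_coneDomain_iff {P : Set (EuclideanSpace ℝ (Fin d))}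
    {x : EuclideanSpace ℝ (Fin d)} : toComplexVec x ∈ coneDomain P ↔ x ∉ P := by
  have him : imVec (toComplexVec x) = 0 := by ext i; simp [imVec, toComplexVec]
  have hre : reVec (toComplexVec x) = x := by ext i; simp [reVec, toComplexVec]
  simp only [coneDomain, mem_ofPred_eq, him, hre, norm_zero, norm_pos_iff, sub_ne_zero]
  exact ⟨fun h hx => h x hx rfl, fun h z hz hxz => h (hxz ▸ hz)⟩

/-- At real points, `thetaMellin` is the Mellin integral of a theta sum over `(1, ∞)`. -/
theorem thetaMellin_toComplexVec {A : Matrix (Fin d) (Fin d) ℝ} (hA : A.det ≠ 0)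
    {P : Set (EuclideanSpace ℝ (Fin d))} (hP : P ⊆ lattice A) (s : ℂ)
    {x : EuclideanSpace ℝ (Fin d)} (y : EuclideanSpace ℝ (Fin d)) (hx : x ∉ P) :
    IntegrableOn (fun t : ℝ => (t : ℂ) ^ (s - 1) * ∑' z : P, thetaTerm x y t z) (Ioi 1) ∧
      thetaMellin P (s, toComplexVec x, toComplexVec y) =
        ∫ t in Ioi (1 : ℝ), (t : ℂ) ^ (s - 1) * ∑' z : P, thetaTerm x y t z := by
  have := ((countable_lattice A).mono hP).to_subtype
  have hint := integrable_thetaKernel hA hP (p := (s, toComplexVec x, toComplexVec y))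
    (toComplexVec_mem_coneDomain_iff.2 hx)
  have hinner : (fun t : ℝ => ∫ z : P, thetaKernel (s, toComplexVec x, toComplexVec y) t z
      ∂Measure.count) =ᵐ[volume.restrict (Ioi 1)]
      fun t : ℝ => (t : ℂ) ^ (s - 1) * ∑' z : P, thetaTerm x y t z := by
    filter_upwards [hint.prod_right_ae] with t ht
    rw [integral_countable ht]
    simp only [thetaKernel_toComplexVec, measureReal_def, Measure.count_singleton,
      ENNReal.toReal_one, one_smul]
    rw [tsum_mul_left]
  refine ⟨hint.integral_prod_left.congr hinner, ?_⟩
  rw [thetaMellin, integral_prod _ hint]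
  exact integral_congr_ae hinner

/-! ### The Mellin transform of the theta function -/

theorem tsum_subtype_eq_tsum_diff_singleton_add {α : Type*} {s : Set α} {f : α → ℂ}
    (hf : Summable fun a : s => f a) (b : α) [Decidable (b ∈ s)] :
    ∑' a : s, f a = ∑' a : ↥(s \ {b}), f a + if b ∈ s then f b else 0 := by
  split_ifs with hb
  · have h := Summable.tsum_union_disjoint (f := f) (s := s \ {b}) (t := {b})
      Set.disjoint_sdiff_left
      (hf.comp_injective (Set.inclusion_injective sdiff_subset))
      (Summable.of_finite)
    rw [Set.sdiff_union_of_subset (singleton_subset_iff.2 hb)] at h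
    rw [h, tsum_singleton]
  · rw [sdiff_singleton_eq_self hb, add_zero]

/-- Riemann's splitting of a Mellin integral at `t = 1`. -/
theorem mellin_eq_integral_Ioi_one_add {f : ℝ → ℂ} {s : ℂ}
    (h₁ : IntegrableOn (fun t : ℝ => (t : ℂ) ^ (s - 1) * f t) (Ioi 1))
    (h₂ : IntegrableOn (fun t : ℝ => (t : ℂ) ^ (-s - 1) * f t⁻¹) (Ioi 1)) :
    mellin f s = (∫ t in Ioi (1 : ℝ), (t : ℂ) ^ (s - 1) * f t) +
      ∫ t in Ioi (1 : ℝ), (t : ℂ) ^ (-s - 1) * f t⁻¹ := by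
  have hind (g : ℝ → ℂ) (w : ℂ) : (fun t : ℝ => (t : ℂ) ^ (w - 1) • (Ioi 1).indicator g t) =
      (Ioi 1).indicator fun t : ℝ => (t : ℂ) ^ (w - 1) * g t := by
    ext t
    by_cases ht : t ∈ Ioi (1 : ℝ) <;> simp [ht]
  have hsub : (Ioi (1 : ℝ)) ∩ Ioi 0 = Ioi 1 := by
    ext t; simp only [mem_inter_iff, mem_Ioi]; constructor
    · exact fun h => h.1
    · exact fun h => ⟨h, zero_lt_one.trans h⟩
  have hconv {g : ℝ → ℂ} {w : ℂ}
      (hg : IntegrableOn (fun t : ℝ => (t : ℂ) ^ (w - 1) * g t) (Ioi 1)) :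
      MellinConvergent ((Ioi 1).indicator g) w := by
    rw [MellinConvergent, hind, IntegrableOn, integrable_indicator_iff measurableSet_Ioi,
      IntegrableOn, Measure.restrict_restrict measurableSet_Ioi, hsub]
    exact hg
  have hval (g : ℝ → ℂ) (w : ℂ) : mellin ((Ioi 1).indicator g) w =
      ∫ t in Ioi (1 : ℝ), (t : ℂ) ^ (w - 1) * g t := by
    rw [mellin, hind, integral_indicator measurableSet_Ioi,
      Measure.restrict_restrict measurableSet_Ioi, hsub]
  have hc₁ := hconv h₁
  have hc₂ : MellinConvergent (fun t : ℝ => (Ioi 1).indicator (fun u => f u⁻¹) t⁻¹) s := by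
    have := (MellinConvergent.comp_rpow (f := (Ioi 1).indicator (fun u => f u⁻¹)) (s := s)
      (a := -1) (by norm_num)).2 (by simpa [div_neg] using hconv h₂)
    simpa only [Real.rpow_neg_one] using this
  rw [← hval f s, ← hval (fun t => f t⁻¹) (-s), ← mellin_comp_inv, ← (hasMellin_add hc₁ hc₂).2]
  refine setIntegral_congr_ae measurableSet_Ioi ?_
  -- the two indicators cover `(0, ∞)` up to the point `1`
  have hne : ∀ᵐ t : ℝ, t ≠ 1 := by simp [ae_iff, measure_singleton]
  filter_upwards [hne] with t ht ht0
  have ht0' : (0 : ℝ) < t := ht0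
  congr 1
  rcases lt_or_gt_of_ne ht with h | h
  · have h' : 1 < t⁻¹ := (one_lt_inv₀ ht0').2 h
    simp [h.not_gt, h']
  · have h' : ¬ 1 < t⁻¹ := not_lt.2 (inv_le_one_of_one_le₀ h.le)
    simp [h, h']

open Classical in
/-- The transformation formula with the non-decaying terms at `x` and `y` separated. -/
theorem tsum_thetaTerm_inv {A : Matrix (Fin d) (Fin d) ℝ} (hA : A.det ≠ 0)
    (x y : EuclideanSpace ℝ (Fin d)) {t : ℝ} (ht : 0 < t) :
    ∑' z : ↥(lattice A \ {x}), thetaTerm x y t⁻¹ z =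
      ((|A.det|⁻¹ : ℝ) : ℂ) * Complex.exp (-2 * π * Complex.I * (inner ℝ x y : ℝ)) *
        ((t : ℂ) ^ (d / 2 : ℂ) * ∑' q : ↥(reciprocalLattice A \ {y}), thetaTerm y (-x) t q) +
      (if y ∈ reciprocalLattice A then ((|A.det|⁻¹ : ℝ) : ℂ) else 0) * (t : ℂ) ^ (d / 2 : ℂ) -
      if x ∈ lattice A then Complex.exp (-2 * π * Complex.I * (inner ℝ y x : ℝ)) else 0 := by
  have hB := det_transpose_inv_ne_zero hA
  have h := tsum_lattice_thetaTerm hA x y (inv_pos.2 ht)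
  rw [inv_inv, tsum_subtype_eq_tsum_diff_singleton_add (f := thetaTerm x y t⁻¹)
      (summable_thetaTerm hA subset_rfl x y (inv_pos.2 ht)) x,
    tsum_subtype_eq_tsum_diff_singleton_add (f := thetaTerm y (-x) t)
      (s := reciprocalLattice A)
      (summable_thetaTerm hB subset_rfl y (-x) ht) y] at h
  have h1 : thetaTerm x y t⁻¹ x = Complex.exp (-2 * π * Complex.I * (inner ℝ y x : ℝ)) := by
    simp [thetaTerm]
  have h2 : Complex.exp (-2 * π * Complex.I * (inner ℝ x y : ℝ)) * thetaTerm y (-x) t y = 1 := by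
    simp [thetaTerm, ← Complex.exp_add]
  rw [h1] at h
  rw [eq_sub_iff_add_eq, h]
  split_ifs with hy
  · linear_combination ((|A.det|⁻¹ : ℝ) : ℂ) * (t : ℂ) ^ (d / 2 : ℂ) * h2
  · ring

/-- The jointly holomorphic part of the Epstein zeta function of a lattice of covolume `V`, at
`p = (ν, u, w)`. The sets `P` and `Q` consist of the points of the lattice and of the reciprocal
lattice over which the two theta sums run. -/
def epsteinMain (V : ℝ) (P Q : Set (EuclideanSpace ℝ (Fin d)))
    (p : ℂ × EuclideanSpace ℂ (Fin d) × EuclideanSpace ℂ (Fin d)) : ℂ :=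
  π ^ (p.1 / 2) * (Complex.Gamma (p.1 / 2))⁻¹ *
    (thetaMellin P (p.1 / 2, p.2.1, p.2.2) +
      ((V⁻¹ : ℝ) : ℂ) * Complex.exp (-2 * π * Complex.I * bilin p.2.1 p.2.2) *
        thetaMellin Q ((d - p.1) / 2, p.2.2, -p.2.1))

open Classical in
/-- The theta sum without the term at `x` has a Mellin transform for `Re s > d / 2`, expressed by
integrals that converge for all `s` and two explicit polar terms. -/
theorem mellin_tsum_thetaTerm {A : Matrix (Fin d) (Fin d) ℝ} (hA : A.det ≠ 0)
    (x y : EuclideanSpace ℝ (Fin d)) {s : ℂ} (hs : (d : ℝ) / 2 < s.re) :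
    mellin (fun t => ∑' z : ↥(lattice A \ {x}), thetaTerm x y t z) s =
      thetaMellin (lattice A \ {x}) (s, toComplexVec x, toComplexVec y) +
      ((|A.det|⁻¹ : ℝ) : ℂ) * Complex.exp (-2 * π * Complex.I * (inner ℝ x y : ℝ)) *
        thetaMellin (reciprocalLattice A \ {y}) (d / 2 - s, toComplexVec y, -toComplexVec x) +
      (if y ∈ reciprocalLattice A then ((|A.det|⁻¹ : ℝ) : ℂ) else 0) * (1 / (s - d / 2)) -
      (if x ∈ lattice A then Complex.exp (-2 * π * Complex.I * (inner ℝ y x : ℝ)) else 0) *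
        (1 / s) := by
  have hB := det_transpose_inv_ne_zero hA
  have hneg : -toComplexVec x = toComplexVec (-x) := by ext i; simp [toComplexVec]
  obtain ⟨hi₁, he₁⟩ := thetaMellin_toComplexVec hA (P := lattice A \ {x}) sdiff_subset s
    (x := x) y (by simp)
  obtain ⟨hi₂, he₂⟩ := thetaMellin_toComplexVec hB (P := reciprocalLattice A \ {y}) sdiff_subset
    (d / 2 - s) (x := y) (-x) (by simp)
  have hs0 : 0 < s.re := lt_of_le_of_lt (by positivity) hs
  have hp₁ : (-s - 1 + d / 2 : ℂ).re < -1 := by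
    have : ((d : ℂ) / 2).re = d / 2 := by simp
    rw [Complex.add_re, this, Complex.sub_re, Complex.neg_re, Complex.one_re]
    linarith
  have hp₂ : (-s - 1 : ℂ).re < -1 := by
    rw [Complex.sub_re, Complex.neg_re, Complex.one_re]
    linarith
  have hk₁ := integrableOn_Ioi_cpow_of_lt hp₁ one_pos
  have hk₂ := integrableOn_Ioi_cpow_of_lt hp₂ one_pos
  set V : ℂ := ((|A.det|⁻¹ : ℝ) : ℂ)
  set e : ℂ := Complex.exp (-2 * π * Complex.I * (inner ℝ x y : ℝ))
  set δ : ℂ := if y ∈ reciprocalLattice A then V else 0 with hδ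
  set ε : ℂ := if x ∈ lattice A then Complex.exp (-2 * π * Complex.I * (inner ℝ y x : ℝ)) else 0
    with hε
  set Ψ : ℝ → ℂ := fun t => ∑' q : ↥(reciprocalLattice A \ {y}), thetaTerm y (-x) t q
  have hinv : EqOn (fun t : ℝ => V * e * ((t : ℂ) ^ (d / 2 - s - 1 : ℂ) * Ψ t) +
        δ * (t : ℂ) ^ (-s - 1 + d / 2 : ℂ) - ε * (t : ℂ) ^ (-s - 1 : ℂ))
      (fun t : ℝ => (t : ℂ) ^ (-s - 1) * ∑' z : ↥(lattice A \ {x}), thetaTerm x y t⁻¹ z)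
      (Ioi 1) := by
    intro t ht
    have ht0 : 0 < t := zero_lt_one.trans ht
    have ht' : (t : ℂ) ≠ 0 := Complex.ofReal_ne_zero.2 ht0.ne'
    simp only
    rw [tsum_thetaTerm_inv hA x y ht0, show (d / 2 - s - 1 : ℂ) = -s - 1 + d / 2 by ring,
      Complex.cpow_add _ _ ht']
    ring
  have hia : IntegrableOn (fun t : ℝ => V * e * ((t : ℂ) ^ (d / 2 - s - 1 : ℂ) * Ψ t)) (Ioi 1) :=
    hi₂.const_mul (V * e)
  have hib : IntegrableOn (fun t : ℝ => δ * (t : ℂ) ^ (-s - 1 + d / 2 : ℂ)) (Ioi 1) :=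
    hk₁.const_mul δ
  have hic : IntegrableOn (fun t : ℝ => ε * (t : ℂ) ^ (-s - 1 : ℂ)) (Ioi 1) :=
    hk₂.const_mul ε
  have hsub := integral_sub (hia.add hib) hic
  have hadd := integral_add hia hib
  simp only [Pi.add_apply] at hsub
  rw [mellin_eq_integral_Ioi_one_add hi₁
      (IntegrableOn.congr_fun ((hia.add hib).sub hic) hinv measurableSet_Ioi), ← he₁,
    ← setIntegral_congr_fun measurableSet_Ioi hinv, hsub, hadd, integral_const_mul,
    integral_const_mul, integral_const_mul, ← he₂, ← hneg,
    integral_Ioi_cpow_of_lt hp₁ one_pos, integral_Ioi_cpow_of_lt hp₂ one_pos]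
  have hs1 : s ≠ 0 := fun h => by simp [h] at hs0
  have hs2 : s - d / 2 ≠ 0 := fun h => by
    rw [sub_eq_zero] at h
    simp [h] at hs
  have hs3 : -s - 1 + d / 2 + 1 = -(s - d / 2) := by ring
  rw [hs3, sub_add_cancel, Complex.ofReal_one, Complex.one_cpow, Complex.one_cpow, neg_div_neg_eq,
    neg_div_neg_eq]
  ring

theorem differentiableOn_epsteinMain {A : Matrix (Fin d) (Fin d) ℝ} (hA : A.det ≠ 0) (V : ℝ)
    {P Q : Set (EuclideanSpace ℝ (Fin d))} (hP : P ⊆ lattice A) (hQ : Q ⊆ reciprocalLattice A) :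
    DifferentiableOn ℂ (epsteinMain V P Q) (univ ×ˢ (coneDomain P ×ˢ coneDomain Q)) := by
  have hB := det_transpose_inv_ne_zero hA
  have h1 : DifferentiableOn ℂ
      (fun p : ℂ × EuclideanSpace ℂ (Fin d) × EuclideanSpace ℂ (Fin d) =>
        thetaMellin P (p.1 / 2, p.2.1, p.2.2)) (univ ×ˢ (coneDomain P ×ˢ coneDomain Q)) :=
    (differentiableOn_thetaMellin hA hP).comp (by fun_prop) fun p hp =>
      ⟨mem_univ _, hp.2.1, mem_univ _⟩
  have h2 : DifferentiableOn ℂ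
      (fun p : ℂ × EuclideanSpace ℂ (Fin d) × EuclideanSpace ℂ (Fin d) =>
        thetaMellin Q ((d - p.1) / 2, p.2.2, -p.2.1)) (univ ×ˢ (coneDomain P ×ˢ coneDomain Q)) :=
    (differentiableOn_thetaMellin hB hQ).comp (by fun_prop) fun p hp =>
      ⟨mem_univ _, hp.2.2, mem_univ _⟩
  have h3 : Differentiable ℂ
      fun p : ℂ × EuclideanSpace ℂ (Fin d) × EuclideanSpace ℂ (Fin d) => bilin p.2.1 p.2.2 :=
    differentiable_bilin (by fun_prop) (by fun_prop)
  have h4 : Differentiable ℂ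
      fun p : ℂ × EuclideanSpace ℂ (Fin d) × EuclideanSpace ℂ (Fin d) => (π : ℂ) ^ (p.1 / 2) :=
    fun p => (by fun_prop : DifferentiableAt ℂ (fun p : ℂ × EuclideanSpace ℂ (Fin d) ×
      EuclideanSpace ℂ (Fin d) => p.1 / 2) p).const_cpow
        (Or.inl (Complex.ofReal_ne_zero.2 Real.pi_ne_zero))
  have h5 : Differentiable ℂ
      fun p : ℂ × EuclideanSpace ℂ (Fin d) × EuclideanSpace ℂ (Fin d) =>
        (Complex.Gamma (p.1 / 2))⁻¹ :=
    Complex.differentiable_one_div_Gamma.comp (by fun_prop)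
  unfold epsteinMain
  exact (h4.mul h5).differentiableOn.mul
    (h1.add (((h3.const_mul _).cexp.const_mul _).differentiableOn.mul h2))

/-! ### Meromorphic continuation -/

theorem meromorphicOrderAt_add_div_sub {h g : ℂ → ℂ} {c : ℂ} (hh : AnalyticAt ℂ h c)
    (hg : AnalyticAt ℂ g c) (hgc : g c ≠ 0) :
    MeromorphicAt (fun ν => h ν + g ν / (ν - c)) c ∧
      meromorphicOrderAt (fun ν => h ν + g ν / (ν - c)) c = ((-1 : ℤ) : WithTop ℤ) := by
  have hid : AnalyticAt ℂ (fun ν : ℂ => ν - c) c := analyticAt_id.sub analyticAt_const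
  have hm : MeromorphicAt (fun ν => h ν + g ν / (ν - c)) c :=
    hh.meromorphicAt.add (hg.meromorphicAt.div hid.meromorphicAt)
  refine ⟨hm, ?_⟩
  rw [meromorphicOrderAt_eq_int_iff hm]
  refine ⟨fun ν => (ν - c) * h ν + g ν, (hid.mul hh).add hg, by simpa using hgc, ?_⟩
  filter_upwards [self_mem_nhdsWithin] with ν hν
  have : ν - c ≠ 0 := sub_ne_zero.2 hν
  simp only [zpow_neg, zpow_one, smul_eq_mul]
  field_simp

theorem meromorphicNFOn_ite_add_div_sub {h g : ℂ → ℂ} {c : ℂ} (hh : Differentiable ℂ h)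
    (hg : Differentiable ℂ g) (hgc : g c ≠ 0) :
    MeromorphicNFOn (fun ν => if ν = c then 0 else h ν + g ν / (ν - c)) univ := by
  intro a _
  rcases eq_or_ne a c with rfl | hac
  · obtain ⟨hm, ho⟩ := meromorphicOrderAt_add_div_sub (hh.analyticAt a) (hg.analyticAt a) hgc
    have heq : (fun ν => h ν + g ν / (ν - a)) =ᶠ[𝓝[≠] a]
        fun ν => if ν = a then 0 else h ν + g ν / (ν - a) := by
      filter_upwards [self_mem_nhdsWithin] with ν hν
      exact (if_neg hν).symm
    refine meromorphicNFAt_iff_analyticAt_or.2 (Or.inr ⟨hm.congr heq, ?_, if_pos rfl⟩)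
    rw [← meromorphicOrderAt_congr heq, ho]
    exact WithTop.coe_lt_coe.2 (by norm_num)
  · have heq : (fun ν => h ν + g ν / (ν - c)) =ᶠ[𝓝 a]
        fun ν => if ν = c then 0 else h ν + g ν / (ν - c) := by
      filter_upwards [isOpen_ne.mem_nhds hac] with ν hν
      rw [if_neg hν]
    refine AnalyticAt.meromorphicNFAt (AnalyticAt.congr ?_ heq)
    exact (hh.analyticAt a).add ((hg.analyticAt a).div (analyticAt_id.sub analyticAt_const)
      (sub_ne_zero.2 hac))

/-- Identity theorem for meromorphic functions in normal form on `ℂ`. -/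
theorem MeromorphicNFOn.eq_of_eventuallyEq {f g : ℂ → ℂ} (hf : MeromorphicNFOn f univ)
    (hg : MeromorphicNFOn g univ) {c : ℂ} (h : f =ᶠ[𝓝 c] g) : f = g := by
  have hm : MeromorphicOn (f - g) univ := hf.meromorphicOn.sub hg.meromorphicOn
  have htop : meromorphicOrderAt (f - g) c = ⊤ := by
    rw [meromorphicOrderAt_eq_top_iff]
    filter_upwards [h.filter_mono nhdsWithin_le_nhds] with ν hν
    simp [hν]
  ext a
  have ha : meromorphicOrderAt (f - g) a = ⊤ := by
    by_contra hne
    exact hm.meromorphicOrderAt_ne_top_of_isPreconnected isPreconnected_univ (mem_univ a)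
      (mem_univ c) hne htop
  rw [meromorphicOrderAt_eq_top_iff] at ha
  have heq : f =ᶠ[𝓝[≠] a] g := ha.mono fun ν hν => sub_eq_zero.1 hν
  exact (((hf (mem_univ a)).eventuallyEq_nhdsNE_iff_eventuallyEq_nhds (hg (mem_univ a))).1
    heq).self_of_nhds

theorem IsEpsteinContinuation.unique {L : Set (EuclideanSpace ℝ (Fin d))}
    {x y : EuclideanSpace ℝ (Fin d)} {f g : ℂ → ℂ} (hf : IsEpsteinContinuation L x y f)
    (hg : IsEpsteinContinuation L x y g) : f = g := by
  refine hf.1.eq_of_eventuallyEq hg.1 (c := d + 1) ?_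
  have : {ν : ℂ | (d : ℝ) < ν.re} ∈ 𝓝 (d + 1 : ℂ) :=
    (isOpen_lt continuous_const Complex.continuous_re).mem_nhds (by simp)
  filter_upwards [this] with ν hν using (hf.2 ν hν).unique (hg.2 ν hν)

theorem IsEpsteinContinuation.epsteinZeta_eq {L : Set (EuclideanSpace ℝ (Fin d))}
    {x y : EuclideanSpace ℝ (Fin d)} {f : ℂ → ℂ} (hf : IsEpsteinContinuation L x y f) :
    epsteinZeta L x y = f := by
  have h : ∃ f : ℂ → ℂ, IsEpsteinContinuation L x y f := ⟨f, hf⟩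
  rw [epsteinZeta, dif_pos h]
  exact h.choose_spec.unique hf

/-- Absolute convergence of the lattice sum and its representation as a Mellin transform. -/
theorem hasSum_mellin_thetaTerm {A : Matrix (Fin d) (Fin d) ℝ} (hA : A.det ≠ 0)
    (x y : EuclideanSpace ℝ (Fin d)) {ν : ℂ} (hν : (d : ℝ) < ν.re) :
    HasSum (fun z : ↥(lattice A \ {x}) =>
        Complex.exp (-2 * π * Complex.I * (inner ℝ y z.1 : ℝ)) / ((‖x - z.1‖ : ℝ) : ℂ) ^ ν)
      (π ^ (ν / 2) * (Complex.Gamma (ν / 2))⁻¹ *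
        mellin (fun t => ∑' z : ↥(lattice A \ {x}), thetaTerm x y t z) (ν / 2)) := by
  have := ((countable_lattice A).mono (sdiff_subset (s := lattice A) (t := {x}))).to_subtype
  have hν0 : 0 < ν.re := lt_of_le_of_lt (Nat.cast_nonneg d) hν
  have hre : (ν / 2).re = ν.re / 2 := by simp
  have hs : 0 < (ν / 2).re := by rw [hre]; positivity
  have hpos (z : ↥(lattice A \ {x})) : 0 < ‖x - z.1‖ :=
    norm_pos_iff.2 (sub_ne_zero.2 fun h => z.2.2 h.symm)
  have key := hasSum_mellin_pi_mul
    (a := fun z : ↥(lattice A \ {x}) => Complex.exp (-2 * π * Complex.I * (inner ℝ y z.1 : ℝ)))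
    (q := fun z => ‖x - z.1‖ ^ 2)
    (F := fun t => ∑' z : ↥(lattice A \ {x}), thetaTerm x y t z) (s := ν / 2)
    (fun z => Or.inr (pow_pos (hpos z) 2)) hs ?_ ?_
  · refine (key.mul_left (π ^ (ν / 2) * (Complex.Gamma (ν / 2))⁻¹)).congr_fun fun z => ?_
    have hΓ : Complex.Gamma (ν / 2) ≠ 0 := Complex.Gamma_ne_zero_of_re_pos hs
    have hπ : (π : ℂ) ^ (ν / 2) ≠ 0 := by simp [Complex.cpow_eq_zero_iff, Real.pi_ne_zero]
    have hpow : ((‖x - z.1‖ ^ 2 : ℝ) : ℂ) ^ (ν / 2) = ((‖x - z.1‖ : ℝ) : ℂ) ^ ν := by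
      rw [Complex.ofReal_pow, ← Complex.cpow_nat_mul']
      · congr 1
        push_cast
        ring
      all_goals
        rw [Complex.arg_ofReal_of_nonneg (norm_nonneg _)]
        simp [Real.pi_pos, Real.pi_pos.le]
    rw [hpow, Complex.cpow_neg]
    field_simp
  · intro t ht
    refine (summable_thetaTerm hA sdiff_subset x y ht).hasSum.congr_fun fun z => ?_
    rw [thetaTerm]
    ring_nf
  · have h := (summable_lattice_norm_sub_rpow hA x (r := -ν.re) (by linarith)).comp_injective
      (Set.inclusion_injective (sdiff_subset (s := lattice A) (t := {x})))
    refine h.congr fun z => ?_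
    simp only [Function.comp_apply]
    rw [norm_cexp_neg_two_pi_I_mul_ofReal, hre, norm_sub_rev, ← Real.rpow_natCast,
      ← Real.rpow_mul (norm_nonneg _), Real.rpow_neg (norm_nonneg _), one_div]
    congr 2
    push_cast
    ring

/-- The Epstein zeta function without its polar part at `ν = d`; an entire function of `ν`. -/
def epsteinRegular (A : Matrix (Fin d) (Fin d) ℝ) (x y : EuclideanSpace ℝ (Fin d)) (ν : ℂ) : ℂ :=
  open Classical in
  epsteinMain |A.det| (lattice A \ {x}) (reciprocalLattice A \ {y})
      (ν, toComplexVec x, toComplexVec y) -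
    (if x ∈ lattice A then Complex.exp (-2 * π * Complex.I * (inner ℝ y x : ℝ)) else 0) *
      (π ^ (ν / 2) * (Complex.Gamma (ν / 2 + 1))⁻¹)

/-- The numerator of the polar part `epsteinPolar A ν / (ν - d)` of the Epstein zeta function for
`y` in the reciprocal lattice. -/
def epsteinPolar (A : Matrix (Fin d) (Fin d) ℝ) (ν : ℂ) : ℂ :=
  ((|A.det|⁻¹ : ℝ) : ℂ) * (π ^ (ν / 2) * (Complex.Gamma (ν / 2))⁻¹ * 2)

theorem differentiable_cpow_mul_inv_Gamma (a : ℂ) :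
    Differentiable ℂ fun ν : ℂ => (π : ℂ) ^ (ν / 2) * (Complex.Gamma (ν / 2 + a))⁻¹ := by
  have h1 : Differentiable ℂ fun ν : ℂ => (π : ℂ) ^ (ν / 2) := fun ν =>
    (by fun_prop : DifferentiableAt ℂ (fun ν : ℂ => ν / 2) ν).const_cpow
      (Or.inl (Complex.ofReal_ne_zero.2 Real.pi_ne_zero))
  have h2 : Differentiable ℂ fun ν : ℂ => (Complex.Gamma (ν / 2 + a))⁻¹ :=
    Complex.differentiable_one_div_Gamma.comp (by fun_prop)
  exact h1.mul h2

theorem differentiable_epsteinPolar (A : Matrix (Fin d) (Fin d) ℝ) :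
    Differentiable ℂ (epsteinPolar A) := by
  have := differentiable_cpow_mul_inv_Gamma 0
  simp only [add_zero] at this
  exact (this.mul_const 2).const_mul _

theorem epsteinPolar_ne_zero {A : Matrix (Fin d) (Fin d) ℝ} (hA : A.det ≠ 0) (hd : 0 < d) :
    epsteinPolar A d ≠ 0 := by
  have hΓ : Complex.Gamma ((d : ℂ) / 2) ≠ 0 := by
    refine Complex.Gamma_ne_zero_of_re_pos ?_
    have : ((d : ℂ) / 2).re = d / 2 := by simp
    rw [this]
    positivity
  have hπ : (π : ℂ) ^ ((d : ℂ) / 2) ≠ 0 := by simp [Complex.cpow_eq_zero_iff, Real.pi_ne_zero]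
  have hV : ((|A.det|⁻¹ : ℝ) : ℂ) ≠ 0 := by
    simpa using hA
  exact mul_ne_zero hV (mul_ne_zero (mul_ne_zero hπ (inv_ne_zero hΓ)) two_ne_zero)

theorem differentiable_epsteinRegular {A : Matrix (Fin d) (Fin d) ℝ} (hA : A.det ≠ 0)
    (x y : EuclideanSpace ℝ (Fin d)) : Differentiable ℂ (epsteinRegular A x y) := by
  have h1 : DifferentiableOn ℂ (fun ν : ℂ => epsteinMain |A.det| (lattice A \ {x})
      (reciprocalLattice A \ {y}) (ν, toComplexVec x, toComplexVec y)) univ :=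
    (differentiableOn_epsteinMain hA |A.det| sdiff_subset sdiff_subset).comp
      (f := fun ν : ℂ => (ν, toComplexVec x, toComplexVec y)) (by fun_prop) fun ν _ =>
        ⟨mem_univ _, toComplexVec_mem_coneDomain_iff.2 (by simp),
          toComplexVec_mem_coneDomain_iff.2 (by simp)⟩
  rw [differentiableOn_univ] at h1
  exact h1.sub ((differentiable_cpow_mul_inv_Gamma 1).const_mul _)

/-- The meromorphic continuation of the lattice sum of `A ℤ^d`, in normal form. -/
def epsteinContinuation (A : Matrix (Fin d) (Fin d) ℝ) (x y : EuclideanSpace ℝ (Fin d)) : ℂ → ℂ :=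
  open Classical in
  if y ∈ reciprocalLattice A then
    fun ν => if ν = d then 0 else epsteinRegular A x y ν + epsteinPolar A ν / (ν - d)
  else epsteinRegular A x y

theorem isEpsteinContinuation_epsteinContinuation {A : Matrix (Fin d) (Fin d) ℝ}
    (hA : A.det ≠ 0) (hd : 0 < d) (x y : EuclideanSpace ℝ (Fin d)) :
    IsEpsteinContinuation (lattice A) x y (epsteinContinuation A x y) := by
  classical
  refine ⟨?_, fun ν hν => ?_⟩
  · unfold epsteinContinuation
    split_ifs with hy
    · exact meromorphicNFOn_ite_add_div_sub (differentiable_epsteinRegular hA x y)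
        (differentiable_epsteinPolar A) (epsteinPolar_ne_zero hA hd)
    · exact fun ν _ => ((differentiable_epsteinRegular hA x y).analyticAt ν).meromorphicNFAt
  · have hνd : ν ≠ d := fun h => by simp [h] at hν
    have hre : (ν / 2).re = ν.re / 2 := by simp
    have hν0 : ν ≠ 0 := fun h => by
      rw [h, Complex.zero_re] at hν
      exact absurd hν (not_lt.2 (Nat.cast_nonneg d))
    have hsum := hasSum_mellin_thetaTerm hA x y hν
    rw [mellin_tsum_thetaTerm hA x y (by rw [hre]; linarith)] at hsum
    have hΓ : (Complex.Gamma (ν / 2))⁻¹ * (1 / (ν / 2)) = (Complex.Gamma (ν / 2 + 1))⁻¹ := by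
      rw [Complex.Gamma_add_one _ (div_ne_zero hν0 two_ne_zero), mul_inv_rev, one_div]
    have hpole : 1 / (ν / 2 - d / 2) = 2 / (ν - d) := by
      rw [← sub_div, one_div_div]
    convert hsum using 1
    have hval : epsteinContinuation A x y ν = epsteinRegular A x y ν +
        if y ∈ reciprocalLattice A then epsteinPolar A ν / (ν - d) else 0 := by
      unfold epsteinContinuation
      split_ifs <;> simp [hνd]
    rw [hval, epsteinRegular, epsteinMain, epsteinPolar, bilin_toComplexVec, ← hΓ, hpole, sub_div]
    split_ifs <;> ring

theorem epsteinZeta_lattice {A : Matrix (Fin d) (Fin d) ℝ} (hA : A.det ≠ 0) (hd : 0 < d)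
    (x y : EuclideanSpace ℝ (Fin d)) :
    epsteinZeta (lattice A) x y = epsteinContinuation A x y :=
  (isEpsteinContinuation_epsteinContinuation hA hd x y).epsteinZeta_eq

end

theorem mainTheorem2 {d : ℕ} (hd : 0 < d) (A : Matrix (Fin d) (Fin d) ℝ) (hA : A.det ≠ 0) :
    -- the Epstein zeta function is well defined
    (∀ x y : EuclideanSpace ℝ (Fin d),
      IsEpsteinContinuation (lattice A) x y (epsteinZeta (lattice A) x y)) ∧
    -- generic `x` and `y`
    (∃ F : ℂ × EuclideanSpace ℂ (Fin d) × EuclideanSpace ℂ (Fin d) → ℂ,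
      IsHolomorphicOn F
        (univ ×ˢ (coneDomain (lattice A) ×ˢ coneDomain (reciprocalLattice A))) ∧
      ∀ (ν : ℂ) (x y : EuclideanSpace ℝ (Fin d)), x ∉ lattice A → y ∉ reciprocalLattice A →
        F (ν, toComplexVec x, toComplexVec y) = epsteinZeta (lattice A) x y ν) ∧
    -- `x` in the lattice, generic `y`
    (∀ x ∈ lattice A, ∃ F : ℂ × EuclideanSpace ℂ (Fin d) → ℂ,
      IsHolomorphicOn F (univ ×ˢ coneDomain (reciprocalLattice A)) ∧
      ∀ (ν : ℂ) (y : EuclideanSpace ℝ (Fin d)), y ∉ reciprocalLattice A →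
        F (ν, toComplexVec y) = epsteinZeta (lattice A) x y ν) ∧
    -- `y` in the reciprocal lattice, generic `x`
    (∀ y ∈ reciprocalLattice A, ∃ F : ℂ × EuclideanSpace ℂ (Fin d) → ℂ,
      IsHolomorphicOn F (({(d : ℂ)}ᶜ : Set ℂ) ×ˢ coneDomain (lattice A)) ∧
      (∀ (ν : ℂ) (x : EuclideanSpace ℝ (Fin d)), ν ≠ (d : ℂ) → x ∉ lattice A →
        F (ν, toComplexVec x) = epsteinZeta (lattice A) x y ν) ∧
      ∀ u ∈ coneDomain (lattice A),
        meromorphicOrderAt (fun ν : ℂ => F (ν, u)) (d : ℂ) = ((-1 : ℤ) : WithTop ℤ)) ∧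
    -- `x` in the lattice and `y` in the reciprocal lattice
    (∀ x ∈ lattice A, ∀ y ∈ reciprocalLattice A,
      IsHolomorphicOn (epsteinZeta (lattice A) x y) ({(d : ℂ)}ᶜ : Set ℂ) ∧
      meromorphicOrderAt (epsteinZeta (lattice A) x y) (d : ℂ) = ((-1 : ℤ) : WithTop ℤ)) := by
  have hB := det_transpose_inv_ne_zero hA
  have hoΛ : IsOpen (coneDomain (lattice A)) := isOpen_coneDomain hA subset_rfl
  have hoΛ' : IsOpen (coneDomain (reciprocalLattice A)) := isOpen_coneDomain hB subset_rfl
  have hmem (L : Set (EuclideanSpace ℝ (Fin d))) (x) : toComplexVec x ∈ coneDomain (L \ {x}) :=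
    toComplexVec_mem_coneDomain_iff.2 (by simp)
  have hpol : DifferentiableOn ℂ (fun ν : ℂ => epsteinPolar A ν / (ν - d)) {(d : ℂ)}ᶜ :=
    (differentiable_epsteinPolar A).differentiableOn.div (by fun_prop)
      fun ν hν => sub_ne_zero.2 hν
  refine ⟨fun x y => ?_, ?_, fun x hx => ?_, fun y hy => ?_, fun x hx y hy => ?_⟩
  · rw [epsteinZeta_lattice hA hd]
    exact isEpsteinContinuation_epsteinContinuation hA hd x y
  · refine ⟨epsteinMain |A.det| (lattice A) (reciprocalLattice A),
      ⟨isOpen_univ.prod (hoΛ.prod hoΛ'),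
        differentiableOn_epsteinMain hA _ subset_rfl subset_rfl⟩, fun ν x y hx hy => ?_⟩
    rw [epsteinZeta_lattice hA hd, epsteinContinuation, if_neg hy, epsteinRegular, if_neg hx,
      sdiff_singleton_eq_self hx, sdiff_singleton_eq_self hy, zero_mul, sub_zero]
  · refine ⟨fun p => epsteinMain |A.det| (lattice A \ {x}) (reciprocalLattice A)
        (p.1, toComplexVec x, p.2) -
      Complex.exp (-2 * π * Complex.I * bilin p.2 (toComplexVec x)) *
        (π ^ (p.1 / 2) * (Complex.Gamma (p.1 / 2 + 1))⁻¹),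
      ⟨isOpen_univ.prod hoΛ', ?_⟩, fun ν y hy => ?_⟩
    · refine DifferentiableOn.sub ?_ (Differentiable.differentiableOn ?_)
      · exact (differentiableOn_epsteinMain hA _ sdiff_subset subset_rfl).comp
          (f := fun p : ℂ × EuclideanSpace ℂ (Fin d) => (p.1, toComplexVec x, p.2))
          (by fun_prop) fun p hp => ⟨mem_univ _, hmem _ x, hp.2⟩
      · have h1 : Differentiable ℂ fun p : ℂ × EuclideanSpace ℂ (Fin d) =>
            bilin p.2 (toComplexVec x) := differentiable_bilin (by fun_prop) (by fun_prop)
        exact (h1.const_mul _).cexp.mul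
          ((differentiable_cpow_mul_inv_Gamma 1).comp differentiable_fst)
    · rw [epsteinZeta_lattice hA hd, epsteinContinuation, if_neg hy, epsteinRegular, if_pos hx,
        sdiff_singleton_eq_self hy, ← bilin_toComplexVec]
  · have hmain : DifferentiableOn ℂ (fun p : ℂ × EuclideanSpace ℂ (Fin d) =>
        epsteinMain |A.det| (lattice A) (reciprocalLattice A \ {y}) (p.1, p.2, toComplexVec y))
        (univ ×ˢ coneDomain (lattice A)) :=
      (differentiableOn_epsteinMain hA _ subset_rfl sdiff_subset).comp
        (f := fun p : ℂ × EuclideanSpace ℂ (Fin d) => (p.1, p.2, toComplexVec y))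
        (by fun_prop) fun p hp => ⟨mem_univ _, hp.2, hmem _ y⟩
    refine ⟨fun p => epsteinMain |A.det| (lattice A) (reciprocalLattice A \ {y})
        (p.1, p.2, toComplexVec y) + epsteinPolar A p.1 / (p.1 - d),
      ⟨isOpen_compl_singleton.prod hoΛ, ?_⟩, fun ν x hν hx => ?_, fun u hu => ?_⟩
    · exact (hmain.mono (prod_mono_left (subset_univ _))).add
        (hpol.comp differentiableOn_fst fun p hp => hp.1)
    · rw [epsteinZeta_lattice hA hd, epsteinContinuation, if_pos hy, if_neg hν, epsteinRegular,
        if_neg hx, sdiff_singleton_eq_self hx, zero_mul, sub_zero]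
    · have h1 : Differentiable ℂ fun ν : ℂ => epsteinMain |A.det| (lattice A)
          (reciprocalLattice A \ {y}) (ν, u, toComplexVec y) := by
        rw [← differentiableOn_univ]
        exact hmain.comp (f := fun ν : ℂ => (ν, u)) (by fun_prop) fun ν _ => ⟨mem_univ _, hu⟩
      exact (meromorphicOrderAt_add_div_sub (h1.analyticAt d)
        ((differentiable_epsteinPolar A).analyticAt d) (epsteinPolar_ne_zero hA hd)).2
  · have hreg := differentiable_epsteinRegular hA x y
    have heq : EqOn (fun ν => epsteinRegular A x y ν + epsteinPolar A ν / (ν - d))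
        (epsteinZeta (lattice A) x y) {(d : ℂ)}ᶜ := by
      intro ν hν
      rw [epsteinZeta_lattice hA hd, epsteinContinuation, if_pos hy]
      exact (if_neg hν).symm
    refine ⟨⟨isOpen_compl_singleton, ?_⟩, ?_⟩
    · exact (hreg.differentiableOn.add hpol).congr heq.symm
    · rw [← meromorphicOrderAt_congr (eventually_of_mem self_mem_nhdsWithin heq)]
      exact (meromorphicOrderAt_add_div_sub (hreg.analyticAt d)
        ((differentiable_epsteinPolar A).analyticAt d) (epsteinPolar_ne_zero hA hd)).2
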